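/- **Setting.** Let $d\ge 2$, $T>0$, let $\Omega\subset\mathbb R^d$ be a bounded open set with smooth boundary, and let $\Omega_1$ be a $C^3$ strictly convex domain with $\overline{\Omega_1}\subset\Omega$. Put $\Omega_2=\Omega\setminus\overline{\Omega_1}$, $\Gamma_*=\partial\Omega_1$, $\Sigma_*=(-T,T)\times\Gamma_*$, let $\nu_1$ be the unit normal to $\Gamma_*$ exterior to $\Omega_1$, and $\nu_2=-\nu_1$. Let $0<\alpha_0\le\alpha^0$ and $\gamma>1$, and let $a=a_j$ in $\Omega_j$ ($j=1,2$), where * (A.1) $\alpha_0\le a\le\alpha^0$ in $\Omega_1\cup\Omega_2$; * (A.2) $a_j\in C^2(\overline{\Omega_j})$, $j=1,2$; * (A.3) $\max_{\Gamma_*}\lambda<\gamma<\min_{\Gamma_*}\lambda^2$, where $\lambda=a_1/a_2$ on $\Gamma_*$. Let $x_1\in\Omega_1$, let $p(x)=\inf\{h>0:(x-x_1)/h\in\Omega_1-x_1\}$, let $0<\varepsilon_1<\varepsilon$ with $\overline{B}_\varepsilon(x_1)\subset\Omega_1$, and let $\eta\in C^\infty(\Omega_1)$ be a cut-off function with $0\le\eta\le1$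 on $\overline{\Omega_1}$, $\eta=0$ in $B_{\varepsilon_1}(x_1)$ and $\eta=1$ in $\overline{\Omega_1}\setminus\overline B_\varepsilon(x_1)$. Let $M_1>\gamma-1$ and define $$\mu(x)=\mu_1(x)=\eta(x)\,p(x)^2+M_1\ \ (x\in\overline{\Omega_1}),\qquad \mu(x)=\mu_2(x)=\gamma\,p(x)^2+M_1-\gamma+1\ \ (x\in\overline{\Omega_2}\setminus\overline{\Omega_1}).$$ (This weight satisfies $\mu_1=\mu_2=1+M_1$, $\gamma\,\partial_{\nu_1}\mu_1+\partial_{\nu_2}\mu_2=0$ and $\partial_{\nu_1}\mu_1\ge 2/\mathrm{diam}(\Omega)$ on $\Gamma_*$.) For $\beta>0$ let $\varphi(t,x)=\mu(x)-\beta t^2$ and $\varphi_j(t,x)=\mu_j(x)-\beta t^2$. Finally let $\alpha$ be a function with $\alpha=\alpha_{(j)}\in C(\overline{\Omega_j})$ in $\Omega_j$. For $s>0$ and $v_j\in C^1([-T,T]\times\overline{\Omega_j})$, $j=1,2$, with the transmission conditions $$v_1=v_2,\qquad a_1\,\partial_{\nu_1}v_1+a_2\,\partial_{\nu_2}v_2=0\qquad\text{on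 }\Sigma_*,$$ put $w_j=e^{s\varphi_j}v_j$ and write $w$ for the common trace $w_1=w_2$ on $\Sigma_*$. The interface terms are $[B_{\Gamma_*}]=\sum_{i=1}^6[J_i]$ with $[J_i]=B_i(\Omega_1)+B_i(\Omega_2)$ and, all integrands being traces from inside $\Omega_j$, $$\begin{aligned} B_1(\Omega_j)&=-s\iint_{\Sigma_*}|\partial_t w_j|^2a_j\,\partial_{\nu_j}\varphi_j\,d\sigma dt, & B_2(\Omega_j)&=2s\iint_{\Sigma_*}a_j\,\partial_{\nu_j}w_j\,\partial_t\varphi_j\,\partial_tw_j\,d\sigma dt,\\ B_3(\Omega_j)&=-2s\iint_{\Sigma_*}a_j^2\,(\nabla\varphi_j\cdot\nabla w_j)\,\partial_{\nu_j}w_j\,d\sigma dt, & B_4(\Omega_j)&=s\iint_{\Sigma_*}|\nabla w_j|^2a_j^2\,\partial_{\nu_j}\varphi_j\,d\sigma dt,\\ B_5(\Omega_j)&=-s\iint_{\Sigma_*}\alpha_{(j)} a_j^2\,\partial_{\nu_j}w_j\,w_j\,d\sigma dt, & B_6(\Omega_j)&=s^3\iint_{\Sigma_*}|w_j|^2a_j\big(|\partial_t\varphi_j|^2-a_j|\nabla\varphi_j|^2\big)\partial_{\nu_j}\varphi_j\,d\sigma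 dt. \end{aligned}$$ **Proposition (Interface integrals).** If $$0<\beta<\frac{2\alpha_0}{\mathrm{diam}(\Omega)^2(1+M_1)},$$ then there exist $s_0>0$, $C>0$ and $c>0$ such that, for all $s\ge s_0$ and all $v_1,v_2$ as above, $$-Cs^3\iint_{\Sigma_*\cap\{\varphi<0\}}|w|^2\,d\sigma dt-Cs^2\int_{\Gamma_*}\big(|w(T)|^2+|w(-T)|^2\big)\,d\sigma\ \le\ [B_{\Gamma_*}],$$ and moreover $$c\,s\iint_{\Sigma_*}\big(|\partial_tw|^2+s^2|w|^2+|\nabla_\tau w|^2+|\partial_{\nu_1}w_1|^2\big)d\sigma dt-Cs^3\iint_{\Sigma_*\cap\{\varphi<0\}}|w|^2\,d\sigma dt-Cs^2\int_{\Gamma_*}\big(|w(T)|^2+|w(-T)|^2\big)\,d\sigma\ \le\ [B_{\Gamma_*}],$$ where $\nabla_\tau w=\nabla w_1-(\partial_{\nu_1}w_1)\nu_1$ is the tangential gradient. -/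

import Mathlib

open MeasureTheory Set Filter Topology
open scoped ContDiff Gradient

namespace InterfaceCarleman

noncomputable section

/-- `ψ` is a local defining function of class `C^k` of the set `U` near the point `x`:
on the open neighbourhood `V` of `x`, `U` is `{ψ < 0}`, and `∇ψ(x) ≠ 0`. -/
def IsLocalDefiningFunction {d : ℕ} (k : WithTop ℕ∞) (U : Set (EuclideanSpace ℝ (Fin d)))
    (x : EuclideanSpace ℝ (Fin d)) (V : Set (EuclideanSpace ℝ (Fin d)))
    (ψ : EuclideanSpace ℝ (Fin d) → ℝ) : Prop :=
  IsOpen V ∧ x ∈ V ∧ ContDiffOn ℝ k ψ V ∧ gradient ψ x ≠ 0 ∧ ∀ y ∈ V, (y ∈ U ↔ ψ y < 0)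

/-- The boundary of `U` is of class `C^k` (with `U` locally on one side of it). -/
def HasCkBoundary {d : ℕ} (k : WithTop ℕ∞) (U : Set (EuclideanSpace ℝ (Fin d))) : Prop :=
  ∀ x ∈ frontier U, ∃ V ψ, IsLocalDefiningFunction k U x V ψ

/-- A strictly convex domain: an open, nonempty convex set whose closure is strictly convex, that
is, whose boundary contains no segment. -/
structure IsStrictlyConvexDomain {d : ℕ} (U : Set (EuclideanSpace ℝ (Fin d))) : Prop where
  isOpen : IsOpen U
  nonempty : U.Nonempty
  convex : Convex ℝ U
  strictConvex_closure : StrictConvex ℝ (closure U)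

/-- The exterior unit normal of `U` at a boundary point `x` where the boundary is `C^1`: it is
`∇ψ(x) / |∇ψ(x)|` for a local defining function `ψ` (and it does not depend on `ψ`). -/
def outwardNormal {d : ℕ} (U : Set (EuclideanSpace ℝ (Fin d))) (x : EuclideanSpace ℝ (Fin d)) :
    EuclideanSpace ℝ (Fin d) :=
  Classical.epsilon fun n =>
    ∃ V ψ, IsLocalDefiningFunction 1 U x V ψ ∧ n = ‖gradient ψ x‖⁻¹ • gradient ψ x

/-- The Minkowski functional of the translated set `U - x₁`, evaluated at `x - x₁`. -/
def minkowski {d : ℕ} (U : Set (EuclideanSpace ℝ (Fin d))) (x₁ x : EuclideanSpace ℝ (Fin d)) : ℝ :=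
  gauge ((fun y => y - x₁) '' U) (x - x₁)

/-- A smooth cut-off function on `U`, vanishing on `B_{ε₁}(x₁)` and equal to one off the closed
ball of radius `ε`, this closed ball being contained in `U`. -/
structure IsCutoff {d : ℕ} (U : Set (EuclideanSpace ℝ (Fin d))) (x₁ : EuclideanSpace ℝ (Fin d))
    (ε₁ ε : ℝ) (η : EuclideanSpace ℝ (Fin d) → ℝ) : Prop where
  pos : 0 < ε₁
  lt : ε₁ < ε
  closedBall_subset : Metric.closedBall x₁ ε ⊆ U
  contDiffOn : ContDiffOn ℝ ∞ η U
  mem_Icc : ∀ x ∈ closure U, η x ∈ Icc (0 : ℝ) 1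
  eq_zero : ∀ x ∈ Metric.ball x₁ ε₁, η x = 0
  eq_one : ∀ x ∈ closure U \ Metric.closedBall x₁ ε, η x = 1

/-- The spatial weight in the inner domain, `η p² + M₁`. -/
def innerWeight {d : ℕ} (Ω₁ : Set (EuclideanSpace ℝ (Fin d))) (x₁ : EuclideanSpace ℝ (Fin d))
    (η : EuclideanSpace ℝ (Fin d) → ℝ) (M₁ : ℝ) (x : EuclideanSpace ℝ (Fin d)) : ℝ :=
  η x * minkowski Ω₁ x₁ x ^ 2 + M₁

/-- The spatial weight in the outer domain, `γ p² + M₂` with `M₂ = M₁ - γ + 1`. -/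
def outerWeight {d : ℕ} (Ω₁ : Set (EuclideanSpace ℝ (Fin d))) (x₁ : EuclideanSpace ℝ (Fin d))
    (γ M₁ : ℝ) (x : EuclideanSpace ℝ (Fin d)) : ℝ :=
  γ * minkowski Ω₁ x₁ x ^ 2 + (M₁ - γ + 1)

open Classical in
/-- The spatial weight `μ` on the whole domain: `innerWeight` on the closure of `Ω₁`,
`outerWeight` elsewhere. -/
def spatialWeight {d : ℕ} (Ω₁ : Set (EuclideanSpace ℝ (Fin d))) (x₁ : EuclideanSpace ℝ (Fin d))
    (η : EuclideanSpace ℝ (Fin d) → ℝ) (γ M₁ : ℝ) (x : EuclideanSpace ℝ (Fin d)) : ℝ :=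
  if x ∈ closure Ω₁ then innerWeight Ω₁ x₁ η M₁ x else outerWeight Ω₁ x₁ γ M₁ x

/-- The space-time weight `φ(t, x) = μ(x) - β t²`. -/
def weight {d : ℕ} (β : ℝ) (μ : EuclideanSpace ℝ (Fin d) → ℝ)
    (z : ℝ × EuclideanSpace ℝ (Fin d)) : ℝ :=
  μ z.2 - β * z.1 ^ 2

/-- The conjugated function `w = e^{sφ} v`. -/
def conjugate {d : ℕ} (s : ℝ) (φ v : ℝ × EuclideanSpace ℝ (Fin d) → ℝ)
    (z : ℝ × EuclideanSpace ℝ (Fin d)) : ℝ :=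
  Real.exp (s * φ z) * v z

/-- The time derivative on `[-T, T]` (one-sided at the end points). -/
def timeDeriv {d : ℕ} (T : ℝ) (f : ℝ × EuclideanSpace ℝ (Fin d) → ℝ)
    (z : ℝ × EuclideanSpace ℝ (Fin d)) : ℝ :=
  derivWithin (fun t => f (t, z.2)) (Icc (-T) T) z.1

/-- The spatial gradient relative to the closure of `U`; at a boundary point of `U` it is the trace
of the gradient, taken from inside `U`. -/
def spaceGrad {d : ℕ} (U : Set (EuclideanSpace ℝ (Fin d)))
    (f : ℝ × EuclideanSpace ℝ (Fin d) → ℝ) (z : ℝ × EuclideanSpace ℝ (Fin d)) :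
    EuclideanSpace ℝ (Fin d) :=
  gradientWithin (fun x => f (z.1, x)) (closure U) z.2

/-- The derivative of `f` in the direction of the vector field `ν`, from inside `U`. -/
def normalDeriv {d : ℕ} (U : Set (EuclideanSpace ℝ (Fin d)))
    (ν : EuclideanSpace ℝ (Fin d) → EuclideanSpace ℝ (Fin d))
    (f : ℝ × EuclideanSpace ℝ (Fin d) → ℝ) (z : ℝ × EuclideanSpace ℝ (Fin d)) : ℝ :=
  inner ℝ (spaceGrad U f z) (ν z.2)

/-- The tangential gradient `∇_τ f = ∇f - (∂_ν f) ν`. -/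
def tangentialGrad {d : ℕ} (U : Set (EuclideanSpace ℝ (Fin d)))
    (ν : EuclideanSpace ℝ (Fin d) → EuclideanSpace ℝ (Fin d))
    (f : ℝ × EuclideanSpace ℝ (Fin d) → ℝ) (z : ℝ × EuclideanSpace ℝ (Fin d)) :
    EuclideanSpace ℝ (Fin d) :=
  spaceGrad U f z - normalDeriv U ν f z • ν z.2

/-- The surface measure `dσ` on a hypersurface `Γ` of `ℝ^d`. -/
def surfaceMeasure {d : ℕ} (Γ : Set (EuclideanSpace ℝ (Fin d))) :
    Measure (EuclideanSpace ℝ (Fin d)) :=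
  (Measure.euclideanHausdorffMeasure (d - 1)).restrict Γ

/-- The measure `dσ dt` on `(-T, T) × Γ`. -/
def lateralMeasure {d : ℕ} (T : ℝ) (Γ : Set (EuclideanSpace ℝ (Fin d))) :
    Measure (ℝ × EuclideanSpace ℝ (Fin d)) :=
  ((volume : Measure ℝ).restrict (Ioo (-T) T)).prod (surfaceMeasure Γ)

/-- The six boundary integrals over `(-T, T) × Γ`, for a part `Γ` of the boundary of `U` with
exterior normal `ν`, produced by integrating by parts the product `(P₁w, P₂w)` in
`(-T, T) × U`. -/
def boundaryTerm {d : ℕ} (T : ℝ) (Γ U : Set (EuclideanSpace ℝ (Fin d)))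
    (ν : EuclideanSpace ℝ (Fin d) → EuclideanSpace ℝ (Fin d))
    (a α : EuclideanSpace ℝ (Fin d) → ℝ) (s : ℝ)
    (φ w : ℝ × EuclideanSpace ℝ (Fin d) → ℝ) : Fin 6 → ℝ :=
  ![-s * ∫ z, timeDeriv T w z ^ 2 * a z.2 * normalDeriv U ν φ z ∂(lateralMeasure T Γ),
    2 * s * ∫ z, a z.2 * normalDeriv U ν w z * timeDeriv T φ z * timeDeriv T w z
      ∂(lateralMeasure T Γ),
    -2 * s * ∫ z, a z.2 ^ 2 * inner ℝ (spaceGrad U φ z) (spaceGrad U w z) * normalDeriv U ν w z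
      ∂(lateralMeasure T Γ),
    s * ∫ z, ‖spaceGrad U w z‖ ^ 2 * a z.2 ^ 2 * normalDeriv U ν φ z ∂(lateralMeasure T Γ),
    -s * ∫ z, α z.2 * a z.2 ^ 2 * normalDeriv U ν w z * w z ∂(lateralMeasure T Γ),
    s ^ 3 * ∫ z, w z ^ 2 * a z.2 * (timeDeriv T φ z ^ 2 - a z.2 * ‖spaceGrad U φ z‖ ^ 2)
      * normalDeriv U ν φ z ∂(lateralMeasure T Γ)]

end

end InterfaceCarleman

namespace InterfaceCarleman

/-! ### Convex geometry of the interface through the Minkowski functional -/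

section Geometry

variable {d : ℕ} {U : Set (EuclideanSpace ℝ (Fin d))} {x₁ x : EuclideanSpace ℝ (Fin d)}

/-! Let `p` be the Minkowski functional. On the interface `p = 1` and `∇p = q ν₁` with `q > 0`, so
`∇φ₁ = 2qν₁` and `∇φ₂ = 2γqν₁` there. The functions `w₁`, `w₂` share their trace and their time and
tangential derivatives. Put `X = a₁ ∂_{ν₁}w₁`, `W = s w`, `K = γa₂ - a₁`. Conjugation turns the flux
condition into `a₂ ∂_{ν₂}w₂ = -X - 2qKW`, so the second normal derivative can be eliminated
(`interfaceDensity_eq`). The twelve integrands then add up to `2qs` times `K |∂_t w|² + (a₁² - γa₂²)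
|∇_τ w|² + interfaceForm(X, W)`, plus the cross term `8βs²qK t w ∂_t w` and terms of lower order in
`s`.

The jump condition and compactness make `K` and `a₁² - γa₂²` uniformly positive. Completing the
square in `X`, `jump_inequality` leaves at least `4KW²(2q²a₂ - β²t²)`. Homogeneity of `p` gives `q
⟨ν₁, x - x₁⟩ = 1`, hence `q ≥ 1 / diam Ω`. Where `φ ≥ 0` one has `βt² ≤ 1 + M₁`, and the smallness
of `β` is what makes the bracket uniformly positive. Where `φ < 0` the defect is of size `s W² =
s³w²`, the error allowed.

The cross term is integrated in time: `2 t w ∂_t w = ∂_t(t w²) - w²`, its coefficient `qK` is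
nonnegative and independent of `t`, and the end points contribute `T (w(T)² + w(-T)²) ≥ 0`. The
remaining `w²` is of lower order, and large `s` absorbs all lower order terms
(`exists_interfaceDensity_ge`). This gives the second estimate; the first follows because the energy
is nonnegative.

The rest justifies the computation. Radial projection onto the boundary yields the gradient of `p`,
the equality of tangential derivatives and the finiteness of the surface measure; all factors are
bounded and measurable, so every integral converges. -/

theorem image_sub_eq (U : Set (EuclideanSpace ℝ (Fin d))) (x₁ : EuclideanSpace ℝ (Fin d)) :
    (fun y => y - x₁) '' U = (Homeomorph.subRight x₁) '' U := rfl

theorem convex_image_sub (hc : Convex ℝ U) : Convex ℝ ((fun y => y - x₁) '' U) := by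
  simpa [sub_eq_neg_add] using hc.translate (-x₁)

theorem image_sub_mem_nhds (ho : IsOpen U) (hx₁ : x₁ ∈ U) :
    (fun y => y - x₁) '' U ∈ 𝓝 (0 : EuclideanSpace ℝ (Fin d)) := by
  rw [image_sub_eq]
  refine ((Homeomorph.subRight x₁).isOpenMap U ho).mem_nhds ⟨x₁, hx₁, ?_⟩
  simp

theorem exists_lipschitzWith_minkowski (ho : IsOpen U) (hc : Convex ℝ U) (hx₁ : x₁ ∈ U) :
    ∃ K, LipschitzWith K (minkowski U x₁) := by
  obtain ⟨K, hK⟩ := (convex_image_sub hc).lipschitz_gauge (image_sub_mem_nhds ho hx₁)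
  refine ⟨K * 1, hK.comp ?_⟩
  exact LipschitzWith.of_dist_le_mul fun a b => by simp

theorem minkowski_eq_one_iff (ho : IsOpen U) (hc : Convex ℝ U) (hx₁ : x₁ ∈ U) :
    minkowski U x₁ x = 1 ↔ x ∈ frontier U := by
  unfold minkowski
  rw [gauge_eq_one_iff_mem_frontier (convex_image_sub hc) (image_sub_mem_nhds ho hx₁),
    image_sub_eq, ← Homeomorph.image_frontier]
  simp

theorem minkowski_add_smul (y : EuclideanSpace ℝ (Fin d)) {c : ℝ} (hcc : 0 ≤ c) :
    minkowski U x₁ (x₁ + c • y) = c * minkowski U x₁ (x₁ + y) := by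
  simp [minkowski, gauge_smul_of_nonneg hcc]

theorem radial_mem_frontier (ho : IsOpen U) (hc : Convex ℝ U) (hx₁ : x₁ ∈ U)
    (hp : 0 < minkowski U x₁ x) : x₁ + (minkowski U x₁ x)⁻¹ • (x - x₁) ∈ frontier U := by
  rw [← minkowski_eq_one_iff ho hc hx₁, minkowski_add_smul _ (inv_nonneg.2 hp.le)]
  simp [hp.ne']

theorem IsLocalDefiningFunction.hasGradientAt {k : WithTop ℕ∞} {V : Set (EuclideanSpace ℝ (Fin d))}
    {ψ : EuclideanSpace ℝ (Fin d) → ℝ} (h : IsLocalDefiningFunction k U x V ψ) (hk : k ≠ 0) :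
    HasGradientAt ψ (gradient ψ x) x :=
  ((h.2.2.1.differentiableOn hk).differentiableAt (h.1.mem_nhds h.2.1)).hasGradientAt

theorem IsLocalDefiningFunction.eq_zero {k : WithTop ℕ∞} {V : Set (EuclideanSpace ℝ (Fin d))}
    {ψ : EuclideanSpace ℝ (Fin d) → ℝ} (ho : IsOpen U) (h : IsLocalDefiningFunction k U x V ψ)
    {y : EuclideanSpace ℝ (Fin d)} (hyV : y ∈ V) (hy : y ∈ frontier U) : ψ y = 0 := by
  obtain ⟨hV, -, hψ, -, hU⟩ := h
  rw [ho.frontier_eq] at hy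
  refine le_antisymm ?_ (not_lt.1 fun h0 => hy.2 ((hU y hyV).2 h0))
  by_contra! hpos
  have hcont : ContinuousAt ψ y := hψ.continuousOn.continuousAt (hV.mem_nhds hyV)
  have h1 : ∀ᶠ z in 𝓝 y, 0 < ψ z ∧ z ∈ V :=
    (hcont.eventually (lt_mem_nhds hpos)).and (hV.mem_nhds hyV)
  obtain ⟨z, hz, hzU⟩ := mem_closure_iff_nhds.1 hy.1 _ h1
  exact absurd ((hU z hz.2).1 hzU) (not_lt.2 hz.1.le)

/-- The segment from `x` to `y` enters `U` at once, so `ψ` cannot increase along it to first order.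
This is the supporting hyperplane at `x`. -/
theorem IsLocalDefiningFunction.inner_gradient_neg {k : WithTop ℕ∞}
    {V : Set (EuclideanSpace ℝ (Fin d))} {ψ : EuclideanSpace ℝ (Fin d) → ℝ}
    (ho : IsOpen U) (hc : Convex ℝ U) (h : IsLocalDefiningFunction k U x V ψ) (hk : k ≠ 0)
    (hx : x ∈ frontier U) {y : EuclideanSpace ℝ (Fin d)} (hy : y ∈ U) :
    inner ℝ (gradient ψ x) (y - x) < 0 := by
  have key : ∀ y ∈ U, inner ℝ (gradient ψ x) (y - x) ≤ 0 := by
    intro y hy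
    by_contra! hpos
    have hx0 := h.eq_zero ho h.2.1 hx
    have hd : HasDerivAt (fun t : ℝ => ψ (x + t • (y - x))) (inner ℝ (gradient ψ x) (y - x)) 0 := by
      have h1 : HasDerivAt (fun t : ℝ => x + t • (y - x)) (y - x) 0 := by
        simpa using ((hasDerivAt_id (0 : ℝ)).smul_const (y - x)).const_add x
      have h2 := (h.hasGradientAt hk).hasFDerivAt
      exact h2.comp_hasDerivAt_of_eq (0 : ℝ) h1 (by simp)
    have h1 : ∀ᶠ t in 𝓝[>] (0 : ℝ), 0 < slope (fun t : ℝ => ψ (x + t • (y - x))) 0 t :=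
      ((hasDerivWithinAt_iff_tendsto_slope' (by simp)).1
        (hd.hasDerivWithinAt (s := Ioi 0))).eventually (lt_mem_nhds hpos)
    have h2 : ∀ᶠ t in 𝓝[>] (0 : ℝ), x + t • (y - x) ∈ V := by
      have : ContinuousAt (fun t : ℝ => x + t • (y - x)) 0 := by fun_prop
      refine nhdsWithin_le_nhds (this.eventually ?_)
      simpa using h.1.mem_nhds h.2.1
    have h3 : ∀ᶠ t in 𝓝[>] (0 : ℝ), t ∈ Ioc (0 : ℝ) 1 := Ioc_mem_nhdsGT one_pos
    obtain ⟨t, ht1, ht2, ht3⟩ := (h1.and (h2.and h3)).exists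
    have hmem : x + t • (y - x) ∈ U := by
      have := hc.add_smul_sub_mem_interior' (frontier_subset_closure hx)
        (ho.interior_eq.symm ▸ hy) ht3
      rwa [ho.interior_eq] at this
    have hneg := (h.2.2.2.2 _ ht2).1 hmem
    rw [slope_def_field] at ht1
    simp only [zero_smul, add_zero, hx0, sub_zero] at ht1
    exact absurd ht1 (not_lt.2 (div_nonpos_of_nonpos_of_nonneg hneg.le ht3.1.le))
  -- Strictness: if equality held at `y`, moving `y` slightly along `∇ψ(x)` would stay in the open
  -- set `U` and violate the weak inequality.
  refine lt_of_le_of_ne (key y hy) fun h0 => ?_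
  have hcont : ContinuousAt (fun r : ℝ => y + r • gradient ψ x) 0 := by fun_prop
  have h1 : ∀ᶠ r in 𝓝[>] (0 : ℝ), y + r • gradient ψ x ∈ U :=
    nhdsWithin_le_nhds (hcont.eventually (by simpa using ho.mem_nhds hy))
  obtain ⟨r, hr, hr0⟩ := (h1.and self_mem_nhdsWithin).exists
  have h2 := key _ hr
  rw [add_sub_right_comm, inner_add_right, h0, zero_add, inner_smul_right,
    real_inner_self_eq_norm_sq] at h2
  have := norm_pos_iff.2 h.2.2.2.1
  have : (0 : ℝ) < r * ‖gradient ψ x‖ ^ 2 := mul_pos hr0 (by positivity)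
  linarith

/-- The radial projection `R y` lies on the boundary, so `ψ (R y) = 0`. Expanding `ψ` to first order
at `x` gives a linear equation for `p y - 1` up to `o(y - x)`, since `R` moves points by `O(y - x)`.
Only differentiability of `ψ` at `x` and the Lipschitz bound on `p` enter. -/
theorem IsLocalDefiningFunction.hasGradientAt_minkowski {k : WithTop ℕ∞}
    {V : Set (EuclideanSpace ℝ (Fin d))} {ψ : EuclideanSpace ℝ (Fin d) → ℝ}
    (ho : IsOpen U) (hc : Convex ℝ U) (h : IsLocalDefiningFunction k U x V ψ) (hk : k ≠ 0)
    (hx : x ∈ frontier U) (hx₁ : x₁ ∈ U) :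
    HasGradientAt (minkowski U x₁)
      ((inner ℝ (gradient ψ x) (x - x₁))⁻¹ • gradient ψ x) x := by
  set g := gradient ψ x with hg
  set p := minkowski U x₁ with hp
  have hm : 0 < inner ℝ g (x - x₁) := by
    have := h.inner_gradient_neg ho hc hk hx hx₁
    rw [← neg_sub, inner_neg_right] at this
    linarith
  set m := inner ℝ g (x - x₁) with hmdef
  have hpx : p x = 1 := (minkowski_eq_one_iff ho hc hx₁).2 hx
  obtain ⟨K, hK⟩ := exists_lipschitzWith_minkowski ho hc hx₁
  have hpc : ContinuousAt p x := hK.continuous.continuousAt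
  have hp0 : ∀ᶠ y in 𝓝 x, 1 / 2 < p y := hpc.eventually (lt_mem_nhds (by rw [hpx]; norm_num))
  have hp2 : ∀ᶠ y in 𝓝 x, p y < 2 := hpc.eventually (gt_mem_nhds (by rw [hpx]; norm_num))
  let R := fun y => x₁ + (p y)⁻¹ • (y - x₁)
  have hRx : R x = x := by simp [R, hpx]
  have hR : Tendsto R (𝓝 x) (𝓝 x) := by
    have : ContinuousAt R x := by
      refine continuousAt_const.add ((hpc.inv₀ (by simp [hpx])).smul (by fun_prop))
    simpa [ContinuousAt, hRx] using this
  -- Multiplying by `p y` clears the inverse and makes the right side affine in `p y`; pairing it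
  -- with `g` will isolate `1 - p y`.
  have hRdec : ∀ y, 1 / 2 < p y → p y • (R y - x) = (y - x) + (1 - p y) • (x - x₁) := by
    intro y hy
    have : p y ≠ 0 := by linarith
    simp only [R, smul_sub, smul_add, smul_smul, mul_inv_cancel₀ this, one_smul, sub_smul]
    abel
  have hRO : (fun y => R y - x) =O[𝓝 x] fun y => y - x := by
    refine Asymptotics.IsBigO.of_bound (2 * (1 + K * ‖x - x₁‖)) ?_
    filter_upwards [hp0] with y hy
    have h1 := congrArg norm (hRdec y hy)
    have h2 : ‖(y - x) + (1 - p y) • (x - x₁)‖ ≤ ‖y - x‖ + K * ‖y - x‖ * ‖x - x₁‖ := by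
      refine (norm_add_le _ _).trans ?_
      rw [norm_smul]
      gcongr
      have := hK.dist_le_mul x y
      rwa [dist_comm x y, dist_eq_norm, dist_eq_norm, ← hp, hpx] at this
    rw [norm_smul, Real.norm_of_nonneg (by linarith)] at h1
    nlinarith [norm_nonneg (R y - x), norm_nonneg (y - x)]
  have h1 := (hasGradientAt_iff_isLittleO.1 (h.hasGradientAt hk)).comp_tendsto hR
  have h2 := h1.trans_isBigO hRO
  -- Both `ψ (R y)` and `ψ x` vanish, so the remainder of the expansion is the linear term itself.
  have h3 : (fun y => inner ℝ g (R y - x)) =o[𝓝 x] fun y => y - x := by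
    refine h2.neg_left.congr' ?_ EventuallyEq.rfl
    filter_upwards [hp0, hR.eventually (h.1.mem_nhds h.2.1)] with y hy hyV
    have e1 := h.eq_zero ho hyV (radial_mem_frontier ho hc hx₁ (by linarith))
    simp [e1, h.eq_zero ho h.2.1 hx, ← hg]
  have h4 : (fun y => p y * inner ℝ g (R y - x)) =o[𝓝 x] fun y => y - x := by
    refine Asymptotics.IsBigO.trans_isLittleO (Asymptotics.IsBigO.of_bound 2 ?_) h3
    filter_upwards [hp0, hp2] with y hy hy2
    rw [norm_mul, Real.norm_of_nonneg (by linarith)]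
    gcongr
  rw [hasGradientAt_iff_isLittleO]
  refine (h4.const_mul_left (-m⁻¹)).congr' ?_ EventuallyEq.rfl
  filter_upwards [hp0] with y hy
  have h5 := congrArg (inner ℝ g) (hRdec y hy)
  rw [inner_smul_right, inner_add_right, inner_smul_right, ← hmdef] at h5
  rw [h5, inner_smul_left, hpx]
  simp only [conj_trivial]
  field_simp
  ring

/-- First-order data of the Minkowski functional at a point of a `C^1` convex boundary. -/
theorem exists_hasGradientAt_minkowski {k : WithTop ℕ∞} (hk : 1 ≤ k)
    (ho : IsOpen U) (hc : Convex ℝ U) (hU : HasCkBoundary k U) (hx₁ : x₁ ∈ U)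
    (hx : x ∈ frontier U) :
    ‖outwardNormal U x‖ = 1 ∧ (∀ y ∈ U, inner ℝ (outwardNormal U x) (y - x) < 0) ∧
    ∃ q : ℝ, 0 < q ∧ q * inner ℝ (outwardNormal U x) (x - x₁) = 1 ∧
      HasGradientAt (minkowski U x₁) (q • outwardNormal U x) x := by
  have hex : ∃ n V ψ, IsLocalDefiningFunction 1 U x V ψ ∧ n = ‖gradient ψ x‖⁻¹ • gradient ψ x := by
    obtain ⟨V, ψ, h1, h2, h3, h4⟩ := hU x hx
    exact ⟨_, V, ψ, ⟨h1, h2, h3.of_le hk, h4⟩, rfl⟩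
  obtain ⟨V, ψ, h, hn⟩ := Classical.epsilon_spec hex
  change outwardNormal U x = _ at hn
  have hg := norm_pos_iff.2 h.2.2.2.1
  have hm := h.inner_gradient_neg ho hc one_ne_zero hx hx₁
  rw [← neg_sub, inner_neg_right, neg_lt_zero] at hm
  refine ⟨?_, fun y hy => ?_, ‖gradient ψ x‖ * (inner ℝ (gradient ψ x) (x - x₁))⁻¹, by positivity,
    ?_, ?_⟩
  · rw [hn, norm_smul, norm_inv, norm_norm, inv_mul_cancel₀ hg.ne']
  · rw [hn, inner_smul_left]
    exact mul_neg_of_pos_of_neg (by simpa using h.2.2.2.1)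
      (h.inner_gradient_neg ho hc one_ne_zero hx hy)
  · rw [hn, inner_smul_left]
    simp only [conj_trivial]
    field_simp
  · have := h.hasGradientAt_minkowski ho hc one_ne_zero hx hx₁
    convert this using 1
    rw [hn, smul_smul]
    congr 1
    field_simp

/-- The normal derivative of the Minkowski functional. -/
noncomputable def minkowskiSlope (U : Set (EuclideanSpace ℝ (Fin d)))
    (x₁ x : EuclideanSpace ℝ (Fin d)) : ℝ := ‖gradient (minkowski U x₁) x‖

/-- The boundary `Γ` of a convex domain `U` of class `C^1`, seen from the interior point `x₁`:
the facts about the normal `n` and the slope `q` of the Minkowski functional that the interface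
terms involve. -/
theorem hasGradientAt_minkowski {k : WithTop ℕ∞} (hk : 1 ≤ k)
    (ho : IsOpen U) (hc : Convex ℝ U) (hU : HasCkBoundary k U) (hx₁ : x₁ ∈ U)
    (hx : x ∈ frontier U) :
    0 < minkowskiSlope U x₁ x ∧
    minkowskiSlope U x₁ x * inner ℝ (outwardNormal U x) (x - x₁) = 1 ∧
    HasGradientAt (minkowski U x₁) (minkowskiSlope U x₁ x • outwardNormal U x) x := by
  obtain ⟨h1, -, q, hq, hq1, hg⟩ := exists_hasGradientAt_minkowski hk ho hc hU hx₁ hx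
  have : minkowskiSlope U x₁ x = q := by
    rw [minkowskiSlope, hg.gradient, norm_smul, h1, mul_one, Real.norm_of_nonneg hq.le]
  rw [this]
  exact ⟨hq, hq1, hg⟩

/-- Cauchy–Schwarz in the homogeneity relation `q ⟨ν, x - x₁⟩ = 1`. This is how the diameter enters
the condition on `β`. -/
theorem one_le_minkowskiSlope_mul {k : WithTop ℕ∞} (hk : 1 ≤ k)
    (ho : IsOpen U) (hc : Convex ℝ U) (hU : HasCkBoundary k U) (hx₁ : x₁ ∈ U)
    (hx : x ∈ frontier U) {D : ℝ} (hD : dist x x₁ ≤ D) : 1 ≤ minkowskiSlope U x₁ x * D := by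
  obtain ⟨h0, h1, -⟩ := hasGradientAt_minkowski hk ho hc hU hx₁ hx
  have hn := (exists_hasGradientAt_minkowski hk ho hc hU hx₁ hx).1
  rw [← h1]
  gcongr
  refine (real_inner_le_norm _ _).trans ?_
  rwa [hn, one_mul, ← dist_eq_norm]

/-- The derivative of an arbitrary real function is measurable, so no regularity of the boundary is
needed; slope and normal inherit measurability from it. -/
theorem measurable_gradient_minkowski (U : Set (EuclideanSpace ℝ (Fin d)))
    (x₁ : EuclideanSpace ℝ (Fin d)) : Measurable (gradient (minkowski U x₁)) :=
  (InnerProductSpace.toDual ℝ (EuclideanSpace ℝ (Fin d))).symm.continuous.measurable.comp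
    (measurable_fderiv ℝ _)

theorem minkowskiSlope_le {K : NNReal} (hK : LipschitzWith K (minkowski U x₁)) :
    minkowskiSlope U x₁ x ≤ K := by
  rw [minkowskiSlope, gradient, LinearIsometryEquiv.norm_map]
  exact norm_fderiv_le_of_lipschitz ℝ hK

theorem inner_neg_of_mem_closure_lt {n : EuclideanSpace ℝ (Fin d)}
    (hn : ∀ y ∈ U, inner ℝ n (y - x) < 0) {y : EuclideanSpace ℝ (Fin d)} (hy : y ∈ closure U) :
    inner ℝ n (y - x) ≤ 0 := by
  have hcl : IsClosed {y : EuclideanSpace ℝ (Fin d) | inner ℝ n (y - x) ≤ 0} :=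
    isClosed_le (by fun_prop) continuous_const
  exact closure_minimal (fun z hz => (hn z hz).le) hcl hy

/-- The part outside a convex set has unique derivatives at the boundary points of the set. -/
theorem uniqueDiffWithinAt_diff_closure {Ω : Set (EuclideanSpace ℝ (Fin d))} (hΩ : IsOpen Ω)
    (hxΩ : x ∈ Ω) {n : EuclideanSpace ℝ (Fin d)} (hn1 : ‖n‖ = 1)
    (hn : ∀ y ∈ U, inner ℝ n (y - x) < 0) :
    UniqueDiffWithinAt ℝ (Ω \ closure U) x ∧ x ∈ closure (Ω \ closure U) := by
  obtain ⟨r, hr, hball⟩ := Metric.isOpen_iff.1 hΩ x hxΩ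
  let H := {y : EuclideanSpace ℝ (Fin d) | 0 < inner ℝ n (y - x)}
  have hHo : IsOpen H := isOpen_lt continuous_const (by fun_prop)
  have hHc : Convex ℝ H := by
    intro y hy z hz a b ha hb hab
    simp only [H, mem_ofPred_eq] at hy hz ⊢
    have : a • y + b • z - x = a • (y - x) + b • (z - x) := by
      have hb' : b = 1 - a := by linarith
      rw [hb']
      module
    rw [this, inner_add_right, inner_smul_right, inner_smul_right]
    rcases ha.eq_or_lt with rfl | ha
    · have : b = 1 := by linarith
      subst this; linarith
    · have := mul_pos ha hy
      have := mul_nonneg hb hz.le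
      linarith
  -- The supporting half-space `H` misses `closure U`, so the exterior contains a convex set with
  -- nonempty interior having `x` in its closure.
  have hsub : Metric.ball x r ∩ H ⊆ Ω \ closure U := fun y hy =>
    ⟨hball hy.1, fun hyc => absurd (inner_neg_of_mem_closure_lt hn hyc) (not_le.2 hy.2)⟩
  have hmem : ∀ᶠ t in 𝓝[>] (0 : ℝ), x + t • n ∈ Metric.ball x r ∩ H := by
    have h1 : ContinuousAt (fun t : ℝ => x + t • n) 0 := by fun_prop
    have h2 : ∀ᶠ t in 𝓝[>] (0 : ℝ), x + t • n ∈ Metric.ball x r :=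
      nhdsWithin_le_nhds (h1.preimage_mem_nhds (by simpa using Metric.ball_mem_nhds x hr))
    filter_upwards [h2, self_mem_nhdsWithin] with t ht ht0
    refine ⟨ht, ?_⟩
    simpa [H, inner_smul_right, hn1] using ht0
  have hcl : x ∈ closure (Metric.ball x r ∩ H) := by
    refine mem_closure_of_tendsto (f := fun t : ℝ => x + t • n) (b := 𝓝[>] 0) ?_ hmem
    have h1 : ContinuousAt (fun t : ℝ => x + t • n) 0 := by fun_prop
    simpa [ContinuousAt] using h1.tendsto.mono_left nhdsWithin_le_nhds
  refine ⟨(uniqueDiffWithinAt_convex ((convex_ball x r).inter hHc) ?_ hcl).mono hsub,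
    closure_mono hsub hcl⟩
  obtain ⟨t, ht⟩ := hmem.exists
  exact ⟨_, by rwa [(Metric.isOpen_ball.inter hHo).interior_eq]⟩

/-- Two functions that agree on the boundary of a convex domain have the same tangential
derivatives there. -/
theorem inner_gradient_eq_of_eqOn_frontier {k : WithTop ℕ∞} (hk : 1 ≤ k)
    (ho : IsOpen U) (hc : Convex ℝ U) (hU : HasCkBoundary k U) (hx₁ : x₁ ∈ U)
    (hx : x ∈ frontier U) {A B : Set (EuclideanSpace ℝ (Fin d))} (hA : frontier U ⊆ A)
    {f g : EuclideanSpace ℝ (Fin d) → ℝ} {f' g' : EuclideanSpace ℝ (Fin d)}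
    (hB : frontier U ⊆ B) (hf : HasGradientWithinAt f f' A x) (hg : HasGradientWithinAt g g' B x)
    (hfg : EqOn f g (frontier U)) {τ : EuclideanSpace ℝ (Fin d)}
    (hτ : inner ℝ (outwardNormal U x) τ = 0) : inner ℝ f' τ = inner ℝ g' τ := by
  obtain ⟨-, -, hgr⟩ := hasGradientAt_minkowski hk ho hc hU hx₁ hx
  set p := minkowski U x₁ with hp
  have hpx : p x = 1 := (minkowski_eq_one_iff ho hc hx₁).2 hx
  -- The tangent line projected radially to the boundary. Since `∇p` is normal, `p` is stationary
  -- along `τ` and `c` has velocity `τ` at `0`; `f` and `g` agree along `c`.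
  let c : ℝ → EuclideanSpace ℝ (Fin d) := fun r => x₁ + (p (x + r • τ))⁻¹ • (x + r • τ - x₁)
  have hl : HasDerivAt (fun r : ℝ => x + r • τ) τ 0 := by
    simpa using ((hasDerivAt_id (0 : ℝ)).smul_const τ).const_add x
  have hpl : HasDerivAt (fun r : ℝ => p (x + r • τ)) 0 0 := by
    have h2 := hgr.hasFDerivAt
    have h4 := h2.comp_hasDerivAt_of_eq (0 : ℝ) hl (by simp)
    have h5 : (InnerProductSpace.toDual ℝ (EuclideanSpace ℝ (Fin d))
        (minkowskiSlope U x₁ x • outwardNormal U x)) τ = 0 := by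
      rw [InnerProductSpace.toDual_apply_apply, inner_smul_left, hτ, mul_zero]
    rw [h5] at h4
    exact h4
  have hc0 : c 0 = x := by simp [c, hpx]
  have hcd : HasDerivAt c τ 0 := by
    have h1 : HasDerivAt c _ 0 :=
      ((hpl.inv (by simp [hpx])).smul (hl.sub_const x₁)).const_add x₁
    simpa [hpx] using h1
  have hev : ∀ᶠ r in 𝓝 (0 : ℝ), c r ∈ frontier U := by
    have h1 : ∀ᶠ r in 𝓝 (0 : ℝ), 0 < p (x + r • τ) :=
      hpl.continuousAt.eventually (lt_mem_nhds (by simp [hpx]))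
    filter_upwards [h1] with r hr using radial_mem_frontier ho hc hx₁ hr
  have main : ∀ {S : Set (EuclideanSpace ℝ (Fin d))} {F : EuclideanSpace ℝ (Fin d) → ℝ}
      {F' : EuclideanSpace ℝ (Fin d)}, frontier U ⊆ S → HasGradientWithinAt F F' S x →
      HasDerivAt (fun r => F (c r)) (inner ℝ F' τ) 0 := by
    intro S F F' hS hF
    have h1 := hF.hasFDerivWithinAt
    rw [← hc0] at h1
    have h2 := h1.comp_hasDerivWithinAt (0 : ℝ) (s := c ⁻¹' S) hcd.hasDerivWithinAt
      (mapsTo_preimage c S)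
    exact h2.hasDerivAt (hev.mono fun r hr => hS hr)
  refine (main hA hf).unique ((main hB hg).congr_of_eventuallyEq ?_)
  filter_upwards [hev] with r hr using hfg hr

end Geometry
-- Finiteness of the surface measure
section SurfaceMeasure

theorem minkowski_pos {d : ℕ} {U : Set (EuclideanSpace ℝ (Fin d))}
    {x₁ x : EuclideanSpace ℝ (Fin d)} (ho : IsOpen U) (hb : Bornology.IsBounded U) (hx₁ : x₁ ∈ U)
    (hx : x ≠ x₁) : 0 < minkowski U x₁ x := by
  unfold minkowski
  rw [gauge_pos (absorbent_nhds_zero (image_sub_mem_nhds ho hx₁))]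
  · exact sub_ne_zero.2 hx
  · rw [NormedSpace.isVonNBounded_iff]
    exact (LipschitzWith.of_dist_le_mul (K := 1) fun a b => by simp).isBounded_image hb

theorem lipschitzWith_insertNth {n : ℕ} (i : Fin (n + 1)) (σ : ℝ) :
    LipschitzWith 1 fun u : Fin n → ℝ => (i.insertNth σ u : Fin (n + 1) → ℝ) := by
  refine LipschitzWith.of_dist_le_mul fun u v => ?_
  rw [NNReal.coe_one, one_mul, dist_pi_le_iff dist_nonneg]
  refine (Fin.forall_iff_succAbove i).2 ⟨by simp, fun j => ?_⟩
  simpa using dist_le_pi_dist u v j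

/-- A radial graph is Lipschitz in the parameter as long as the radius stays positive. -/
theorem exists_lipschitzOnWith_inv_smul {X E : Type*} [PseudoMetricSpace X]
    [NormedAddCommGroup E] [NormedSpace ℝ E] {B : Set X} (hB : IsCompact B) {e : X → E} {G : X → ℝ}
    {K L : NNReal} (he : LipschitzWith L e) (hG : LipschitzWith K G) (hpos : ∀ u ∈ B, 0 < G u)
    (x₁ : E) : ∃ M, LipschitzOnWith M (fun u => x₁ + (G u)⁻¹ • e u) B := by
  obtain ⟨m, hm, hmG⟩ := hB.exists_forall_le' hG.continuous.continuousOn hpos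
  obtain ⟨R, hR⟩ := hB.exists_bound_of_continuousOn he.continuous.continuousOn
  refine ⟨(m⁻¹ * L + K * (m⁻¹ * m⁻¹) * |R|).toNNReal, LipschitzOnWith.of_dist_le_mul ?_⟩
  intro u hu v hv
  rw [Real.coe_toNNReal _ (by positivity), dist_add_left, dist_eq_norm]
  have hGu := hpos u hu
  have hGv := hpos v hv
  have h1 : (G u)⁻¹ • e u - (G v)⁻¹ • e v
      = (G u)⁻¹ • (e u - e v) + ((G v - G u) * ((G u)⁻¹ * (G v)⁻¹)) • e v := by
    have : (G v - G u) * ((G u)⁻¹ * (G v)⁻¹) = (G u)⁻¹ - (G v)⁻¹ := by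
      field_simp
    rw [this]
    module
  have h2 : ‖e u - e v‖ ≤ L * dist u v := by simpa [dist_eq_norm] using he.dist_le_mul u v
  have h3 : ‖G v - G u‖ ≤ K * dist u v := by
    simpa [dist_eq_norm, dist_comm] using hG.dist_le_mul v u
  have h4 : (G u)⁻¹ ≤ m⁻¹ := inv_anti₀ hm (hmG u hu)
  have h5 : (G v)⁻¹ ≤ m⁻¹ := inv_anti₀ hm (hmG v hv)
  have h6 : ‖e v‖ ≤ |R| := (hR v hv).trans (le_abs_self R)
  rw [h1, add_mul]
  refine (norm_add_le _ _).trans (add_le_add ?_ ?_)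
  · rw [norm_smul, Real.norm_of_nonneg (by positivity), mul_assoc]
    gcongr
  · rw [norm_smul, norm_mul, Real.norm_of_nonneg (r := (G u)⁻¹ * (G v)⁻¹) (by positivity)]
    calc ‖G v - G u‖ * ((G u)⁻¹ * (G v)⁻¹) * ‖e v‖
        ≤ (K * dist u v) * (m⁻¹ * m⁻¹) * |R| := by gcongr
      _ = _ := by ring

/-- On `Fin n → ℝ` with the sup metric, `n`-dimensional Hausdorff measure is Lebesgue measure,
finite on the cube; a Lipschitz map multiplies it by at most `M ^ n`. -/
theorem hausdorffMeasure_image_Icc_lt_top {n : ℕ} {X : Type*} [MetricSpace X]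
    [MeasurableSpace X] [BorelSpace X] {M : NNReal} {F : (Fin n → ℝ) → X}
    (hF : LipschitzOnWith M F (Icc (fun _ => -1) fun _ => 1)) :
    Measure.hausdorffMeasure (n : ℝ) (F '' Icc (fun _ => -1) fun _ => 1) < ⊤ := by
  refine (hF.hausdorffMeasure_image_le n.cast_nonneg).trans_lt ?_
  refine ENNReal.mul_lt_top (ENNReal.rpow_lt_top_of_nonneg n.cast_nonneg ENNReal.coe_ne_top) ?_
  have := hausdorffMeasure_pi_real (ι := Fin n)
  rw [Fintype.card_fin] at this
  rw [this]
  exact isCompact_Icc.measure_lt_top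

/-- The boundary of a bounded convex open set has finite surface measure: it is the union of the
radial projections of the faces of a cube. -/
theorem isFiniteMeasure_surfaceMeasure {d : ℕ} (hd : 1 ≤ d) {U : Set (EuclideanSpace ℝ (Fin d))}
    (ho : IsOpen U) (hc : Convex ℝ U) (hb : Bornology.IsBounded U) (hne : U.Nonempty) :
    IsFiniteMeasure (surfaceMeasure (frontier U)) := by
  obtain ⟨x₁, hx₁⟩ := hne
  obtain ⟨n, rfl⟩ : ∃ n, d = n + 1 := ⟨d - 1, by omega⟩
  obtain ⟨K, hK⟩ := exists_lipschitzWith_minkowski ho hc hx₁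
  let e : Fin (n + 1) → ℝ → (Fin n → ℝ) → EuclideanSpace ℝ (Fin (n + 1)) :=
    fun i σ u => WithLp.toLp 2 (i.insertNth σ u)
  let F : Fin (n + 1) → ℝ → (Fin n → ℝ) → EuclideanSpace ℝ (Fin (n + 1)) :=
    fun i σ u => x₁ + (minkowski U x₁ (x₁ + e i σ u))⁻¹ • e i σ u
  let B : Set (Fin n → ℝ) := Icc (fun _ => -1) fun _ => 1
  have hF : ∀ i σ, σ ≠ 0 → Measure.hausdorffMeasure (n : ℝ) (F i σ '' B) < ⊤ := by
    intro i σ hσ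
    have he : LipschitzWith _ (e i σ) :=
      (PiLp.lipschitzWith_toLp 2 _).comp (lipschitzWith_insertNth i σ)
    have hG : LipschitzWith _ (fun u => minkowski U x₁ (x₁ + e i σ u)) :=
      hK.comp ((LipschitzWith.const x₁).add he)
    obtain ⟨M, hM⟩ := exists_lipschitzOnWith_inv_smul (B := B) isCompact_Icc he hG (fun u _ => by
      refine minkowski_pos ho hb hx₁ fun h => hσ ?_
      have h0 : e i σ u = 0 := by simpa using h
      have := congrArg (fun v : EuclideanSpace ℝ (Fin (n + 1)) => v i) h0
      simpa [e] using this) x₁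
    exact hausdorffMeasure_image_Icc_lt_top hM
  have hsub : frontier U ⊆ ⋃ i : Fin (n + 1), F i 1 '' B ∪ F i (-1) '' B := by
    intro x hx
    have hpx := (minkowski_eq_one_iff ho hc hx₁).2 hx
    have hxne : x ≠ x₁ := by
      rintro rfl
      rw [ho.frontier_eq] at hx
      exact hx.2 hx₁
    -- The coordinate of largest modulus tells which face of the cube the ray from `x₁` through `x`
    -- crosses.
    obtain ⟨i, -, hi⟩ := Finset.exists_max_image Finset.univ (fun i => |(x - x₁) i|)
      Finset.univ_nonempty
    have hi0 : 0 < |(x - x₁) i| := by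
      by_contra! h0
      refine hxne (sub_eq_zero.1 (PiLp.ext fun j => ?_))
      simpa using (hi j (Finset.mem_univ j)).trans h0
    set m := |(x - x₁) i| with hm
    let u : Fin n → ℝ := fun j => m⁻¹ * (x - x₁) (i.succAbove j)
    have hu : u ∈ B := by
      have : ∀ j, |u j| ≤ 1 := fun j => by
        rw [abs_mul, abs_inv, abs_of_pos hi0]
        exact (inv_mul_le_one₀ hi0).2 (hi _ (Finset.mem_univ _))
      exact ⟨fun j => (abs_le.1 (this j)).1, fun j => (abs_le.1 (this j)).2⟩
    have hpt : ∀ σ, (x - x₁) i = m * σ → F i σ u = x := by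
      intro σ hσ
      have h1 : e i σ u = m⁻¹ • (x - x₁) := by
        ext j
        refine (Fin.forall_iff_succAbove i (P := fun j => e i σ u j = (m⁻¹ • (x - x₁)) j)).2
          ⟨?_, fun j => ?_⟩ j
        · simp only [e, Fin.insertNth_apply_same, PiLp.smul_apply, smul_eq_mul, hσ]
          field_simp
        · simp [e, u]
      simp only [F]
      rw [h1, minkowski_add_smul _ (by positivity), add_sub_cancel, hpx, mul_one, inv_inv,
        smul_smul, mul_inv_cancel₀ hi0.ne', one_smul, add_sub_cancel]
    refine mem_iUnion.2 ⟨i, ?_⟩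
    rcases le_total 0 ((x - x₁) i) with h | h
    · exact Or.inl ⟨u, hu, hpt 1 (by rw [mul_one, hm, abs_of_nonneg h])⟩
    · exact Or.inr ⟨u, hu, hpt (-1) (by rw [hm, abs_of_nonpos h]; ring)⟩
  have hfin : Measure.hausdorffMeasure (n : ℝ) (frontier U) < ⊤ := by
    refine (measure_mono hsub).trans_lt ((measure_iUnion_fintype_le _ _).trans_lt ?_)
    refine ENNReal.sum_lt_top.2 fun i _ => (measure_union_le _ _).trans_lt ?_
    exact ENNReal.add_lt_top.2 ⟨hF i 1 one_ne_zero, hF i (-1) (by norm_num)⟩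
  refine ⟨?_⟩
  rw [surfaceMeasure, Measure.restrict_apply_univ, Measure.euclideanHausdorffMeasure_def,
    Measure.smul_apply, Nat.add_sub_cancel]
  exact ENNReal.mul_lt_top ENNReal.coe_lt_top hfin

end SurfaceMeasure
-- Time derivatives and one-sided gradients of `C^1` functions and of their conjugates
section Traces

theorem _root_.HasGradientWithinAt.gradientWithin_eq {F : Type*} [NormedAddCommGroup F]
    [InnerProductSpace ℝ F] [CompleteSpace F] {f : F → ℝ} {f' : F} {s : Set F} {x : F}
    (h : HasGradientWithinAt f f' s x) (hs : UniqueDiffWithinAt ℝ s x) :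
    gradientWithin f s x = f' := by
  rw [gradientWithin, h.hasFDerivWithinAt.fderivWithin hs]
  simp

variable {d : ℕ} {U Ω : Set (EuclideanSpace ℝ (Fin d))} {T : ℝ}
  {v : ℝ × EuclideanSpace ℝ (Fin d) → ℝ} {z : ℝ × EuclideanSpace ℝ (Fin d)}

theorem hasDerivWithinAt_timeDeriv (hT : 0 < T)
    (hv : ContDiffOn ℝ 1 v (Icc (-T) T ×ˢ closure U))
    (hz : z ∈ Icc (-T) T ×ˢ (closure U ∩ Ω)) :
    HasDerivWithinAt (fun t => v (t, z.2)) (timeDeriv T v z) (Icc (-T) T) z.1 ∧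
    timeDeriv T v z = fderivWithin ℝ v (Icc (-T) T ×ˢ (closure U ∩ Ω)) z (1, 0) := by
  have hv' := hv.mono (prod_mono_right (s := Icc (-T) T) (inter_subset_left (s := closure U) (t := Ω)))
  have h1 := (hv'.differentiableOn one_ne_zero z hz).hasFDerivWithinAt
  have h2 : HasDerivWithinAt (fun t : ℝ => (t, z.2)) ((1 : ℝ), (0 : EuclideanSpace ℝ (Fin d)))
      (Icc (-T) T) z.1 := (hasDerivWithinAt_id _ _).prodMk (hasDerivWithinAt_const _ _ _)
  have hmaps : MapsTo (fun t : ℝ => (t, z.2)) (Icc (-T) T) (Icc (-T) T ×ˢ (closure U ∩ Ω)) :=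
    fun t ht => ⟨ht, hz.2⟩
  have h3 := h1.comp_hasDerivWithinAt z.1 h2 hmaps
  have hu : UniqueDiffWithinAt ℝ (Icc (-T) T) z.1 := uniqueDiffOn_Icc (by linarith) _ hz.1
  have h4 : timeDeriv T v z = _ := h3.derivWithin hu
  exact ⟨by rw [h4]; exact h3, h4⟩

/-- Partial derivatives are read off the full derivative on the product set, which gives their
continuity. Intersecting with the open set `Ω` localizes near the interface, away from the outer
boundary, and does not change derivatives within `closure U` at points of `Ω`. -/
theorem hasGradientWithinAt_spaceGrad (hΩ : IsOpen Ω) (hU : UniqueDiffOn ℝ (closure U ∩ Ω))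
    (hv : ContDiffOn ℝ 1 v (Icc (-T) T ×ˢ closure U))
    (hz : z ∈ Icc (-T) T ×ˢ (closure U ∩ Ω)) :
    HasGradientWithinAt (fun x => v (z.1, x)) (spaceGrad U v z) (closure U) z.2 ∧
    spaceGrad U v z = (InnerProductSpace.toDual ℝ (EuclideanSpace ℝ (Fin d))).symm
      ((fderivWithin ℝ v (Icc (-T) T ×ˢ (closure U ∩ Ω)) z).comp
        (ContinuousLinearMap.inr ℝ ℝ (EuclideanSpace ℝ (Fin d)))) := by
  have hv' := hv.mono (prod_mono_right (s := Icc (-T) T) (inter_subset_left (s := closure U) (t := Ω)))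
  have h1 := (hv'.differentiableOn one_ne_zero z hz).hasFDerivWithinAt
  have h2 : HasFDerivWithinAt (fun x : EuclideanSpace ℝ (Fin d) => (z.1, x))
      (ContinuousLinearMap.inr ℝ ℝ (EuclideanSpace ℝ (Fin d))) (closure U ∩ Ω) z.2 :=
    (hasFDerivAt_prodMk_right z.1 z.2).hasFDerivWithinAt
  have hmaps : MapsTo (fun x : EuclideanSpace ℝ (Fin d) => (z.1, x)) (closure U ∩ Ω)
    (Icc (-T) T ×ˢ (closure U ∩ Ω)) := fun x hx => ⟨hz.1, hx⟩
  have h3 := h1.comp z.2 h2 hmaps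
  have h4 := (hasFDerivWithinAt_inter (hΩ.mem_nhds hz.2.2)).1 h3
  have hu : UniqueDiffWithinAt ℝ (closure U) z.2 := (hU z.2 hz.2).mono inter_subset_left
  have h5 := h4.hasGradientWithinAt
  have h6 : spaceGrad U v z = _ := h5.gradientWithin_eq hu
  exact ⟨by rw [h6]; exact h5, h6⟩

theorem continuousOn_timeDeriv (hT : 0 < T) (hU : UniqueDiffOn ℝ (closure U ∩ Ω))
    (hv : ContDiffOn ℝ 1 v (Icc (-T) T ×ˢ closure U)) :
    ContinuousOn (timeDeriv T v) (Icc (-T) T ×ˢ (closure U ∩ Ω)) := by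
  have hv' := hv.mono (prod_mono_right (s := Icc (-T) T) (inter_subset_left (s := closure U) (t := Ω)))
  have h1 := hv'.continuousOn_fderivWithin
    ((uniqueDiffOn_Icc (by linarith : -T < T)).prod hU) le_rfl
  exact (h1.clm_apply continuousOn_const).congr fun z hz => (hasDerivWithinAt_timeDeriv hT hv hz).2

theorem continuousOn_spaceGrad (hT : 0 < T) (hΩ : IsOpen Ω) (hU : UniqueDiffOn ℝ (closure U ∩ Ω))
    (hv : ContDiffOn ℝ 1 v (Icc (-T) T ×ˢ closure U)) :
    ContinuousOn (spaceGrad U v) (Icc (-T) T ×ˢ (closure U ∩ Ω)) := by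
  have hv' := hv.mono (prod_mono_right (s := Icc (-T) T) (inter_subset_left (s := closure U) (t := Ω)))
  have h1 := hv'.continuousOn_fderivWithin
    ((uniqueDiffOn_Icc (by linarith : -T < T)).prod hU) le_rfl
  refine ContinuousOn.congr ?_ fun z hz => (hasGradientWithinAt_spaceGrad hΩ hU hv hz).2
  exact (LinearIsometryEquiv.continuous _).comp_continuousOn (h1.clm_comp continuousOn_const)

variable {β s : ℝ} {μ : EuclideanSpace ℝ (Fin d) → ℝ} {m : EuclideanSpace ℝ (Fin d)}

theorem hasDerivAt_weight (β : ℝ) (μ : EuclideanSpace ℝ (Fin d) → ℝ)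
    (z : ℝ × EuclideanSpace ℝ (Fin d)) :
    HasDerivAt (fun t => weight β μ (t, z.2)) (-2 * β * z.1) z.1 := by
  have := ((hasDerivAt_pow 2 z.1).const_mul β).const_sub (μ z.2)
  have e : -2 * β * z.1 = -(β * (↑2 * z.1 ^ (2 - 1))) := by
    norm_num
    ring
  rw [e]
  exact this

theorem timeDeriv_weight (hT : 0 < T) (hz : z.1 ∈ Icc (-T) T) :
    timeDeriv T (weight β μ) z = -2 * β * z.1 :=
  (hasDerivAt_weight β μ z).hasDerivWithinAt.derivWithin (uniqueDiffOn_Icc (by linarith) _ hz)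

theorem hasGradientWithinAt_weight (hm : HasGradientWithinAt μ m (closure U) z.2) (β : ℝ) :
    HasGradientWithinAt (fun x => weight β μ (z.1, x)) m (closure U) z.2 :=
  hm.hasFDerivWithinAt.sub_const (β * z.1 ^ 2)

theorem spaceGrad_weight (hu : UniqueDiffWithinAt ℝ (closure U) z.2)
    (hm : HasGradientWithinAt μ m (closure U) z.2) : spaceGrad U (weight β μ) z = m :=
  (hasGradientWithinAt_weight hm β).gradientWithin_eq hu

theorem hasDerivWithinAt_conjugate (hT : 0 < T)
    (hv : ContDiffOn ℝ 1 v (Icc (-T) T ×ˢ closure U))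
    (hz : z ∈ Icc (-T) T ×ˢ (closure U ∩ Ω)) :
    HasDerivWithinAt (fun t => conjugate s (weight β μ) v (t, z.2))
      (timeDeriv T (conjugate s (weight β μ) v) z) (Icc (-T) T) z.1 ∧
    timeDeriv T (conjugate s (weight β μ) v) z
      = Real.exp (s * weight β μ z) * (timeDeriv T v z + s * (-2 * β * z.1) * v z) := by
  have h1 := (((hasDerivAt_weight β μ z).const_mul s).exp.hasDerivWithinAt (s := Icc (-T) T)).mul
    (hasDerivWithinAt_timeDeriv hT hv hz).1
  have h2 : timeDeriv T (conjugate s (weight β μ) v) z = _ :=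
    h1.derivWithin (uniqueDiffOn_Icc (by linarith) _ hz.1)
  refine ⟨by rw [h2]; exact h1, h2.trans ?_⟩
  simp only [Prod.mk.eta]
  ring

theorem spaceGrad_conjugate (hΩ : IsOpen Ω) (hU : UniqueDiffOn ℝ (closure U ∩ Ω))
    (hv : ContDiffOn ℝ 1 v (Icc (-T) T ×ˢ closure U))
    (hz : z ∈ Icc (-T) T ×ˢ (closure U ∩ Ω)) (hm : HasGradientWithinAt μ m (closure U) z.2) :
    spaceGrad U (conjugate s (weight β μ) v) z
      = Real.exp (s * weight β μ z) • (spaceGrad U v z + (s * v z) • m) := by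
  have h0 := (hasGradientWithinAt_weight hm β).hasFDerivWithinAt
  have h1 := ((h0.const_mul s).exp).mul
    (hasGradientWithinAt_spaceGrad hΩ hU hv hz).1.hasFDerivWithinAt
  have hu : UniqueDiffWithinAt ℝ (closure U) z.2 := (hU z.2 hz.2).mono inter_subset_left
  have h2 : spaceGrad U (conjugate s (weight β μ) v) z = _ :=
    h1.hasGradientWithinAt.gradientWithin_eq hu
  rw [h2]
  simp only [Prod.mk.eta, map_add, map_smul, LinearIsometryEquiv.symm_apply_apply]
  module

end Traces

/-! ### Values and gradients of the weights on the interface -/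

section Weights

variable {d : ℕ} {U : Set (EuclideanSpace ℝ (Fin d))} {x₁ x n : EuclideanSpace ℝ (Fin d)} {q : ℝ}

theorem hasGradientAt_outerWeight (γ M₁ : ℝ) (hx : minkowski U x₁ x = 1)
    (h : HasGradientAt (minkowski U x₁) (q • n) x) :
    HasGradientAt (outerWeight U x₁ γ M₁) ((2 * γ * q) • n) x := by
  have h1 := ((h.hasFDerivAt.pow 2).const_mul γ).add_const (M₁ - γ + 1)
  have h2 := h1.hasGradientAt
  have e : (2 * γ * q) • n = (InnerProductSpace.toDual ℝ (EuclideanSpace ℝ (Fin d))).symm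
      (γ • (2 • minkowski U x₁ x ^ (2 - 1)) •
        (InnerProductSpace.toDual ℝ (EuclideanSpace ℝ (Fin d))) (q • n)) := by
    simp [hx, smul_smul]
    ring_nf
  rw [e]
  exact h2

/-- Near the boundary the cut-off equals one, and there the inner weight is the outer weight with `γ
= 1`. -/
theorem hasGradientWithinAt_innerWeight {η : EuclideanSpace ℝ (Fin d) → ℝ} {ε₁ ε : ℝ}
    (ho : IsOpen U) (hη : IsCutoff U x₁ ε₁ ε η) (M₁ : ℝ) (hxU : x ∈ frontier U)
    (hx : minkowski U x₁ x = 1) (h : HasGradientAt (minkowski U x₁) (q • n) x) :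
    HasGradientWithinAt (innerWeight U x₁ η M₁) ((2 * q) • n) (closure U) x := by
  have h1 : HasGradientWithinAt (outerWeight U x₁ 1 M₁) ((2 * 1 * q) • n) (closure U) x :=
    (hasGradientAt_outerWeight 1 M₁ hx h).hasFDerivAt.hasFDerivWithinAt
  rw [mul_one] at h1
  have hxb : x ∉ Metric.closedBall x₁ ε := fun hb => by
    rw [ho.frontier_eq] at hxU
    exact hxU.2 (hη.closedBall_subset hb)
  have hev : innerWeight U x₁ η M₁ =ᶠ[𝓝[closure U] x] outerWeight U x₁ 1 M₁ := by
    have : ∀ᶠ y in 𝓝[closure U] x, y ∉ Metric.closedBall x₁ ε :=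
      nhdsWithin_le_nhds (Metric.isClosed_closedBall.isOpen_compl.mem_nhds hxb)
    filter_upwards [this, self_mem_nhdsWithin] with y hy hyU
    simp [innerWeight, outerWeight, hη.eq_one y ⟨hyU, hy⟩]
  exact h1.congr_of_eventuallyEq_of_mem hev (frontier_subset_closure hxU)

theorem innerWeight_eq {η : EuclideanSpace ℝ (Fin d) → ℝ} {ε₁ ε : ℝ}
    (ho : IsOpen U) (hη : IsCutoff U x₁ ε₁ ε η) (M₁ : ℝ) (hxU : x ∈ frontier U)
    (hx : minkowski U x₁ x = 1) : innerWeight U x₁ η M₁ x = 1 + M₁ := by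
  have hxb : x ∉ Metric.closedBall x₁ ε := fun hb => by
    rw [ho.frontier_eq] at hxU
    exact hxU.2 (hη.closedBall_subset hb)
  simp [innerWeight, hx, hη.eq_one x ⟨frontier_subset_closure hxU, hxb⟩]

theorem outerWeight_eq (γ M₁ : ℝ) (hx : minkowski U x₁ x = 1) :
    outerWeight U x₁ γ M₁ x = 1 + M₁ := by
  rw [outerWeight, hx]
  ring

end Weights

/-! ### Bounded functions on the lateral boundary -/

section Integrability

variable {d : ℕ} {Γ : Set (EuclideanSpace ℝ (Fin d))} {T : ℝ}

instance isFiniteMeasure_lateralMeasure [IsFiniteMeasure (surfaceMeasure Γ)] :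
    IsFiniteMeasure (lateralMeasure T Γ) := by
  unfold lateralMeasure
  infer_instance

theorem lateralMeasure_eq_restrict [IsFiniteMeasure (surfaceMeasure Γ)] (hΓ : MeasurableSet Γ) :
    lateralMeasure T Γ = (lateralMeasure T Γ).restrict (Ioo (-T) T ×ˢ Γ) := by
  unfold lateralMeasure
  rw [← Measure.prod_restrict, Measure.restrict_restrict measurableSet_Ioo, inter_self]
  congr 1
  rw [surfaceMeasure, Measure.restrict_restrict hΓ, inter_self]

theorem ae_lateralMeasure [IsFiniteMeasure (surfaceMeasure Γ)] (hΓ : MeasurableSet Γ) :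
    ∀ᵐ z ∂(lateralMeasure T Γ), z ∈ Ioo (-T) T ×ˢ Γ := by
  rw [lateralMeasure_eq_restrict hΓ]
  exact ae_restrict_mem (measurableSet_Ioo.prod hΓ)

theorem memLp_top_of_continuousOn [IsFiniteMeasure (surfaceMeasure Γ)] (hΓ : IsCompact Γ)
    {F : Type*} [NormedAddCommGroup F] [SecondCountableTopology F]
    {f : ℝ × EuclideanSpace ℝ (Fin d) → F}
    (hf : ContinuousOn f (Icc (-T) T ×ˢ Γ)) : MemLp f ⊤ (lateralMeasure T Γ) := by
  obtain ⟨C, hC⟩ := (isCompact_Icc.prod hΓ).exists_bound_of_continuousOn hf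
  have hsub : Ioo (-T) T ×ˢ Γ ⊆ Icc (-T) T ×ˢ Γ := prod_mono_left Ioo_subset_Icc_self
  refine memLp_top_of_bound ?_ C ?_
  · rw [lateralMeasure_eq_restrict hΓ.measurableSet]
    exact (hf.mono hsub).aestronglyMeasurable (measurableSet_Ioo.prod hΓ.measurableSet)
  · filter_upwards [ae_lateralMeasure hΓ.measurableSet] with z hz using hC z (hsub hz)

theorem memLp_top_mul {α : Type*} [MeasurableSpace α] {μ : Measure α} {f g : α → ℝ}
    (hf : MemLp f ⊤ μ) (hg : MemLp g ⊤ μ) : MemLp (fun x => f x * g x) ⊤ μ :=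
  MemLp.mul hg hf

theorem memLp_top_inner {α E : Type*} [MeasurableSpace α] {μ : Measure α} [NormedAddCommGroup E]
    [InnerProductSpace ℝ E] {f g : α → E}
    (hf : MemLp f ⊤ μ) (hg : MemLp g ⊤ μ) : MemLp (fun x => inner ℝ (f x) (g x)) ⊤ μ := by
  refine (memLp_top_mul hf.norm hg.norm).mono (hf.1.inner hg.1) (Eventually.of_forall fun x => ?_)
  rw [norm_mul, norm_norm, norm_norm]
  exact norm_inner_le_norm _ _

end Integrability

/-! ### Pointwise algebra: coercivity of the interface density -/

section Algebra

/-- The coercivity inequality behind the jump condition `λ < γ < λ²`, `λ = a₁ / a₂`. -/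
theorem jump_inequality {a₁ a₂ γ : ℝ} (ha₁ : 0 < a₁) (ha₂ : 0 < a₂) (hγ : 1 < γ)
    (h1 : a₁ ≤ γ * a₂) (h2 : γ * a₂ ^ 2 ≤ a₁ ^ 2) :
    2 * (γ - 1) * a₂ * (γ * a₂ - a₁)
      ≤ (γ - 1) * (γ ^ 3 * a₂ ^ 2 - a₁ ^ 2) - γ * (γ * a₂ - a₁) ^ 2 := by
  obtain ⟨r, hr, rfl⟩ : ∃ r, 1 < r ∧ γ = r ^ 2 :=
    ⟨√γ, by simpa using Real.sqrt_lt_sqrt zero_le_one hγ, (Real.sq_sqrt (by linarith)).symm⟩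
  have h3 : r * a₂ ≤ a₁ := by
    refine le_of_sq_le_sq ?_ ha₁.le
    linarith [mul_pow r a₂ 2]
  -- With `γ = r²` the hypotheses read `r a₂ ≤ a₁ ≤ r² a₂`. The difference of the two sides is a
  -- quadratic form in `(a₁, a₂)`, expanded here in products of the nonnegative quantities `a₁ - r
  -- a₂`, `r² a₂ - a₁` and `a₂`; its coefficients are nonnegative because `r > 1`.
  have e : (r ^ 2 - 1) * ((r ^ 2) ^ 3 * a₂ ^ 2 - a₁ ^ 2) - r ^ 2 * (r ^ 2 * a₂ - a₁) ^ 2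
      - 2 * (r ^ 2 - 1) * a₂ * (r ^ 2 * a₂ - a₁)
      = (2 * r ^ 2 - 1) * ((a₁ - r * a₂) * (r ^ 2 * a₂ - a₁))
        + (r - 1) * (r * (r ^ 4 + 2 * r ^ 3 + r ^ 2 + 2 * r + 1) - 2 * (r + 1)) *
          (a₂ * (r ^ 2 * a₂ - a₁))
        + r ^ 3 * (r - 1) * (r + 1) ^ 2 * (a₂ * (a₁ - r * a₂)) := by ring
  have h4 : 0 ≤ a₁ - r * a₂ := by linarith
  have h5 : 0 ≤ r ^ 2 * a₂ - a₁ := by linarith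
  have h6 : 0 ≤ r - 1 := by linarith
  have h7 : 0 ≤ r * (r ^ 4 + 2 * r ^ 3 + r ^ 2 + 2 * r + 1) - 2 * (r + 1) := by
    have : 1 ≤ r ^ 2 := one_le_pow₀ hr.le
    have : 1 ≤ r ^ 3 := one_le_pow₀ hr.le
    have : 1 ≤ r ^ 4 := one_le_pow₀ hr.le
    have : r * 7 ≤ r * (r ^ 4 + 2 * r ^ 3 + r ^ 2 + 2 * r + 1) := by gcongr; linarith
    linarith
  have h8 : 0 ≤ 2 * r ^ 2 - 1 := by nlinarith
  have : 0 ≤ (2 * r ^ 2 - 1) * ((a₁ - r * a₂) * (r ^ 2 * a₂ - a₁))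
        + (r - 1) * (r * (r ^ 4 + 2 * r ^ 3 + r ^ 2 + 2 * r + 1) - 2 * (r + 1)) *
          (a₂ * (r ^ 2 * a₂ - a₁))
        + r ^ 3 * (r - 1) * (r + 1) ^ 2 * (a₂ * (a₁ - r * a₂)) := by positivity
  linarith

/-- The quadratic form in `X = a₁ ∂_ν w` and `W = s w` of the interface terms. -/
def interfaceForm (a₁ a₂ γ q b X W : ℝ) : ℝ :=
  (γ - 1) * X ^ 2 + 4 * γ * q * (γ * a₂ - a₁) * X * W + 4 * γ * q ^ 2 * (γ * a₂ - a₁) ^ 2 * W ^ 2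
    + 4 * W ^ 2 * (γ ^ 3 * a₂ ^ 2 * q ^ 2 - a₁ ^ 2 * q ^ 2 - b * (γ * a₂ - a₁))

/-- Completing the square in `X` leaves an error which is a nonnegative multiple of the gap in
`jump_inequality`. The parameter `b` stands for `β²t²`. -/
theorem interfaceForm_ge {a₁ a₂ γ q b X W : ℝ} (ha₁ : 0 < a₁) (ha₂ : 0 < a₂) (hγ : 1 < γ)
    (h1 : a₁ ≤ γ * a₂) (h2 : γ * a₂ ^ 2 ≤ a₁ ^ 2) :
    (γ - 1) * (X + 2 * γ * q * (γ * a₂ - a₁) / (γ - 1) * W) ^ 2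
      + 4 * W ^ 2 * ((γ * a₂ - a₁) * (2 * q ^ 2 * a₂ - b)) ≤ interfaceForm a₁ a₂ γ q b X W := by
  have hg : 0 < γ - 1 := by linarith
  have h3 := jump_inequality ha₁ ha₂ hγ h1 h2
  have e : interfaceForm a₁ a₂ γ q b X W
      - ((γ - 1) * (X + 2 * γ * q * (γ * a₂ - a₁) / (γ - 1) * W) ^ 2
      + 4 * W ^ 2 * ((γ * a₂ - a₁) * (2 * q ^ 2 * a₂ - b)))
      = 4 * W ^ 2 * q ^ 2 / (γ - 1) * ((γ - 1) * (γ ^ 3 * a₂ ^ 2 - a₁ ^ 2)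
        - γ * (γ * a₂ - a₁) ^ 2 - 2 * (γ - 1) * a₂ * (γ * a₂ - a₁)) := by
    unfold interfaceForm
    field_simp
    ring
  have : 0 ≤ 4 * W ^ 2 * q ^ 2 / (γ - 1) * ((γ - 1) * (γ ^ 3 * a₂ ^ 2 - a₁ ^ 2)
        - γ * (γ * a₂ - a₁) ^ 2 - 2 * (γ - 1) * a₂ * (γ * a₂ - a₁)) :=
    mul_nonneg (by positivity) (by linarith)
  linarith

/-- The shear `(X, W) ↦ (X + bW, W)` is invertible uniformly in `|b| ≤ B`, so control of the
completed square and of `W` gives back control of `X`. -/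
theorem sq_add_sq_le_of_complete_square {X W b B k e : ℝ} (hk : 0 < k) (he : 0 < e)
    (hb : |b| ≤ B) :
    X ^ 2 + W ^ 2 ≤ (2 / k + (2 * B ^ 2 + 1) / e) * (k * (X + b * W) ^ 2 + e * W ^ 2) := by
  have h1 : b ^ 2 ≤ B ^ 2 := sq_le_sq' (abs_le.1 hb).1 (abs_le.1 hb).2
  have h2 : X ^ 2 + W ^ 2 ≤ 2 * (X + b * W) ^ 2 + (2 * B ^ 2 + 1) * W ^ 2 := by
    nlinarith [sq_nonneg (X + 2 * b * W), mul_le_mul_of_nonneg_right h1 (sq_nonneg W)]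
  have h3 : (2 / k + (2 * B ^ 2 + 1) / e) * (k * (X + b * W) ^ 2 + e * W ^ 2)
      = 2 * (X + b * W) ^ 2 + (2 * B ^ 2 + 1) * W ^ 2
        + (2 / k * e * W ^ 2 + (2 * B ^ 2 + 1) / e * k * (X + b * W) ^ 2) := by
    field_simp
    ring
  have : 0 ≤ 2 / k * e * W ^ 2 + (2 * B ^ 2 + 1) / e * k * (X + b * W) ^ 2 := by positivity
  linarith

/-- Uniform coercivity of the interface form where the weight is nonnegative (`χ = 0`), and its
defect elsewhere (`χ = 1`). -/
theorem exists_interfaceForm_coercive {α₀ A γ δ D Q β M₁ T : ℝ} (hα₀ : 0 < α₀) (hA : 0 < A)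
    (hγ : 1 < γ) (hδ : 0 < δ) (hD : 0 < D) (hβ : 0 < β)
    (hβ' : β < 2 * α₀ / (D ^ 2 * (1 + M₁))) (hM : 0 < 1 + M₁) :
    ∃ c > 0, ∃ C > 0, ∀ a₁ a₂ q t χ X W : ℝ, α₀ ≤ a₁ → α₀ ≤ a₂ → a₂ ≤ A →
      δ ≤ γ * a₂ - a₁ → γ * a₂ ^ 2 ≤ a₁ ^ 2 → 1 ≤ q * D → q ≤ Q → |t| ≤ T →
      (χ = 1 ∨ χ = 0 ∧ β * t ^ 2 ≤ 1 + M₁) →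
      c * (X ^ 2 + W ^ 2) - C * (χ * W ^ 2) ≤ interfaceForm a₁ a₂ γ q (β ^ 2 * t ^ 2) X W := by
  have hg : 0 < γ - 1 := by linarith
  -- Positivity of `κ` is the hypothesis on `β`. It bounds `2q²a₂ - β²t²` from below where `βt² ≤ 1
  -- + M₁`, so `e` below is a valid coefficient of `W²` there.
  set κ := 2 * α₀ / D ^ 2 - β * (1 + M₁) with hκd
  have hκ : 0 < κ := by
    rw [lt_div_iff₀ (by positivity)] at hβ'
    rw [hκd, sub_pos, lt_div_iff₀ (by positivity)]
    linarith
  set e := 4 * (δ * κ) with hed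
  have he : 0 < e := by positivity
  set B := 2 * γ * Q * (γ * A) / (γ - 1) with hB
  set R := 2 / (γ - 1) + (2 * B ^ 2 + 1) / e with hRd
  have hR : 0 < R := by positivity
  -- Where `χ = 1` the remainder is at least `-4γAβ²T²W²`; the additional `e` pays for the term `e
  -- W²` in `hlow`, which then serves both cases.
  refine ⟨R⁻¹, by positivity, e + 4 * (γ * A * (β ^ 2 * T ^ 2)), by positivity, ?_⟩
  intro a₁ a₂ q t χ X W h1 h2 h2A hK h3 hq hqQ ht hχ
  have ha₁ : 0 < a₁ := by linarith
  have ha₂ : 0 < a₂ := by linarith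
  have hq0 : 0 < q := pos_of_mul_pos_left (by linarith) hD.le
  have hKA : γ * a₂ - a₁ ≤ γ * A := by
    have : γ * a₂ ≤ γ * A := by gcongr
    linarith
  have hform := interfaceForm_ge (q := q) (b := β ^ 2 * t ^ 2) (X := X) (W := W) ha₁ ha₂ hγ
    (by linarith) h3
  have hqa : 2 * α₀ / D ^ 2 ≤ 2 * q ^ 2 * a₂ := by
    rw [div_le_iff₀ (by positivity)]
    have : 1 ≤ (q * D) ^ 2 := one_le_pow₀ hq
    calc 2 * α₀ ≤ 2 * a₂ * 1 := by linarith
      _ ≤ 2 * a₂ * (q * D) ^ 2 := by gcongr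
      _ = _ := by ring
  have hb : |2 * γ * q * (γ * a₂ - a₁) / (γ - 1)| ≤ B := by
    have : 0 ≤ γ * a₂ - a₁ := by linarith
    have : 0 < Q := hq0.trans_le hqQ
    rw [abs_of_nonneg (by positivity), hB]
    gcongr
  have hsq := sq_add_sq_le_of_complete_square (X := X) (W := W) hg he hb
  have hlow : R⁻¹ * (X ^ 2 + W ^ 2) ≤ (γ - 1) * (X + 2 * γ * q * (γ * a₂ - a₁) / (γ - 1) * W) ^ 2
      + e * W ^ 2 := by
    rwa [inv_mul_le_iff₀ hR]
  have hW := sq_nonneg W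
  rcases hχ with rfl | ⟨rfl, hχ⟩
  · have h5 : -(γ * A * (β ^ 2 * T ^ 2)) ≤ (γ * a₂ - a₁) * (2 * q ^ 2 * a₂ - β ^ 2 * t ^ 2) := by
      have ht2 : t ^ 2 ≤ T ^ 2 := sq_le_sq' (abs_le.1 ht).1 (abs_le.1 ht).2
      have : (γ * a₂ - a₁) * (β ^ 2 * t ^ 2) ≤ γ * A * (β ^ 2 * T ^ 2) := by gcongr
      have : 0 ≤ (γ * a₂ - a₁) * (2 * q ^ 2 * a₂) := mul_nonneg (by linarith) (by positivity)
      linarith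
    have := mul_le_mul_of_nonneg_left h5 hW
    linarith
  · have h5 : δ * κ ≤ (γ * a₂ - a₁) * (2 * q ^ 2 * a₂ - β ^ 2 * t ^ 2) := by
      have : β * (β * t ^ 2) ≤ β * (1 + M₁) := by gcongr
      have : κ ≤ 2 * q ^ 2 * a₂ - β ^ 2 * t ^ 2 := by linarith
      gcongr
      linarith
    have := mul_le_mul_of_nonneg_left h5 hW
    linarith

/-- The sum of the integrands of the interface terms on both sides of the interface, at a point
with `w`, `∂_t w`, `|∇_τ w|²` equal to `w`, `w'`, `τ`, and with one-sided normal derivatives `g₁`,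
`g₂` along the respective exterior normals. -/
def interfaceDensity (a₁ a₂ α₁ α₂ γ q β t s w w' g₁ g₂ τ : ℝ) : ℝ :=
  (-s * (w' ^ 2 * a₁ * (2 * q)) + 2 * s * (a₁ * g₁ * (-2 * β * t) * w')
    + -2 * s * (a₁ ^ 2 * (2 * q * g₁) * g₁) + s * ((τ + g₁ ^ 2) * a₁ ^ 2 * (2 * q))
    + -s * (α₁ * a₁ ^ 2 * g₁ * w)
    + s ^ 3 * (w ^ 2 * a₁ * ((-2 * β * t) ^ 2 - a₁ * (2 * q) ^ 2) * (2 * q)))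
  + (-s * (w' ^ 2 * a₂ * (-(2 * γ * q))) + 2 * s * (a₂ * g₂ * (-2 * β * t) * w')
    + -2 * s * (a₂ ^ 2 * (-(2 * γ * q) * g₂) * g₂) + s * ((τ + g₂ ^ 2) * a₂ ^ 2 * (-(2 * γ * q)))
    + -s * (α₂ * a₂ ^ 2 * g₂ * w)
    + s ^ 3 * (w ^ 2 * a₂ * ((-2 * β * t) ^ 2 - a₂ * (2 * γ * q) ^ 2) * (-(2 * γ * q))))

/-- The transmission condition determines `Y = a₂g₂` from `X` and `W`. In the mixed time-normal
terms only `a₁g₁ + Y` occurs, in which `X` cancels, so they reduce to a multiple of `t w w'`. -/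
theorem interfaceDensity_eq {a₁ a₂ α₁ α₂ γ q β t s w w' g₁ g₂ τ : ℝ}
    (htr : a₁ * (g₁ - 2 * q * s * w) + a₂ * (g₂ + 2 * γ * q * s * w) = 0) :
    interfaceDensity a₁ a₂ α₁ α₂ γ q β t s w w' g₁ g₂ τ
      = 2 * q * s * (γ * a₂ - a₁) * w' ^ 2 + 2 * q * s * (a₁ ^ 2 - γ * a₂ ^ 2) * τ
        + 2 * q * s * interfaceForm a₁ a₂ γ q (β ^ 2 * t ^ 2) (a₁ * g₁) (s * w)
        - s * w * (α₁ * a₁ * (a₁ * g₁)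
          + α₂ * a₂ * (-(a₁ * g₁) - 2 * q * (γ * a₂ - a₁) * (s * w)))
        + 8 * β * s ^ 2 * q * (γ * a₂ - a₁) * (t * w * w') := by
  obtain ⟨Y, hY⟩ : ∃ Y, Y = a₂ * g₂ := ⟨_, rfl⟩
  have h : Y = -(a₁ * g₁) - 2 * q * (γ * a₂ - a₁) * (s * w) := by
    rw [hY]; linarith
  have e : interfaceDensity a₁ a₂ α₁ α₂ γ q β t s w w' g₁ g₂ τ
      = 2 * q * s * (γ * a₂ - a₁) * w' ^ 2 + 2 * q * s * (a₁ ^ 2 - γ * a₂ ^ 2) * τ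
      + 2 * q * s * (γ * Y ^ 2 - (a₁ * g₁) ^ 2)
      - s * w * (α₁ * a₁ * (a₁ * g₁) + α₂ * a₂ * Y)
      - 4 * β * s * t * w' * (a₁ * g₁ + Y)
      + 8 * q * s ^ 3 * w ^ 2 * (-(β ^ 2 * t ^ 2 * (γ * a₂ - a₁)) - a₁ ^ 2 * q ^ 2
        + γ ^ 3 * a₂ ^ 2 * q ^ 2) := by
    rw [hY, interfaceDensity]
    ring
  rw [e, h, interfaceForm]
  ring

/-- These are the `α` terms and the `w²` left over when `t w w'` is completed to a time derivative.
Their bound lacks the factor `s` of the main form. -/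
theorem lower_order_le {a₁ a₂ α₁ α₂ A a q Q K B β X W : ℝ} (hβ : 0 < β) (ha₁ : 0 < a₁)
    (h1A : a₁ ≤ A) (ha₂ : 0 < a₂) (h2A : a₂ ≤ A) (hα₁ : |α₁| ≤ a) (hα₂ : |α₂| ≤ a) (hq0 : 0 < q)
    (hqQ : q ≤ Q) (hK0 : 0 < K) (hKB : K ≤ B) :
    W * (α₁ * a₁ * X + α₂ * a₂ * (-X - 2 * q * K * W)) + 4 * β * (q * K) * W ^ 2
      ≤ (a * A * (2 + 2 * Q * B) + 4 * β * (Q * B)) * (X ^ 2 + W ^ 2) := by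
  have hX2 := sq_nonneg X
  have hW2 := sq_nonneg W
  have ha0 : 0 ≤ a := (abs_nonneg _).trans hα₁
  have hA0 : 0 ≤ A := ha₁.le.trans h1A
  have hQ0 : 0 ≤ Q := hq0.le.trans hqQ
  have hB0 : 0 ≤ B := hK0.le.trans hKB
  have hXW : |X| * |W| ≤ X ^ 2 + W ^ 2 := by
    rw [← sq_abs X, ← sq_abs W]
    nlinarith only [two_mul_le_add_sq |X| |W|, mul_nonneg (abs_nonneg X) (abs_nonneg W)]
  have hWXW : W ^ 2 ≤ X ^ 2 + W ^ 2 := le_add_of_nonneg_left hX2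
  have e1 : α₁ * a₁ * (X * W) ≤ a * A * (X ^ 2 + W ^ 2) := by
    refine (le_abs_self _).trans ?_
    rw [abs_mul, abs_mul, abs_mul, abs_of_pos ha₁]
    gcongr
  have e2 : α₂ * a₂ * (-(X * W)) ≤ a * A * (X ^ 2 + W ^ 2) := by
    refine (le_abs_self _).trans ?_
    rw [abs_mul, abs_mul, abs_neg, abs_mul, abs_of_pos ha₂]
    gcongr
  have e3 : α₂ * a₂ * (-(2 * q * K) * W ^ 2) ≤ a * A * (2 * Q * B * (X ^ 2 + W ^ 2)) := by
    refine (le_abs_self _).trans ?_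
    rw [abs_mul, abs_mul, abs_mul, abs_neg, abs_of_pos ha₂, abs_of_nonneg hW2,
      abs_of_pos (show 0 < 2 * q * K by positivity)]
    gcongr
  have e4 : 4 * β * (q * K) * W ^ 2 ≤ 4 * β * (Q * B) * (X ^ 2 + W ^ 2) := by
    gcongr
  linarith only [e1, e2, e3, e4]

/-- The pointwise lower bound for the interface density, up to a term that is nonnegative after
integration in time. -/
theorem exists_interfaceDensity_ge {α₀ A γ δ D Q β M₁ T a : ℝ} (hα₀ : 0 < α₀) (hA : 0 < A)
    (hγ : 1 < γ) (hδ : 0 < δ) (hD : 0 < D) (hQ : 0 ≤ Q) (hβ : 0 < β)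
    (hβ' : β < 2 * α₀ / (D ^ 2 * (1 + M₁))) (hM : 0 < 1 + M₁) (ha : 0 ≤ a) :
    ∃ s₀ > 0, ∃ C > 0, ∃ c > 0, ∀ s ≥ s₀, ∀ a₁ a₂ α₁ α₂ q t χ w w' g₁ g₂ τ : ℝ,
      α₀ ≤ a₁ → a₁ ≤ A → α₀ ≤ a₂ → a₂ ≤ A →
      δ ≤ γ * a₂ - a₁ → δ ≤ a₁ ^ 2 - γ * a₂ ^ 2 → 1 ≤ q * D → q ≤ Q → |t| ≤ T →
      |α₁| ≤ a → |α₂| ≤ a → 0 ≤ τ → (χ = 1 ∨ χ = 0 ∧ β * t ^ 2 ≤ 1 + M₁) →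
      a₁ * (g₁ - 2 * q * s * w) + a₂ * (g₂ + 2 * γ * q * s * w) = 0 →
      c * s * (w' ^ 2 + s ^ 2 * w ^ 2 + τ + g₁ ^ 2) - C * s ^ 3 * (χ * w ^ 2)
        + 4 * β * s ^ 2 * (q * (γ * a₂ - a₁) * (2 * t * w * w' + w ^ 2))
        ≤ interfaceDensity a₁ a₂ α₁ α₂ γ q β t s w w' g₁ g₂ τ := by
  obtain ⟨c₀, hc₀, C₀, hC₀, hform⟩ := exists_interfaceForm_coercive (Q := Q) (T := T)
    hα₀ hA hγ hδ hD hβ hβ' hM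
  set p := D⁻¹ with hp
  have hp0 : 0 < p := inv_pos.2 hD
  set L := a * A * (2 + 2 * Q * (γ * A)) + 4 * β * (Q * (γ * A)) with hL
  have hL0 : 0 ≤ L := by positivity
  set c := min (2 * p * δ) (min (p * c₀) (p * c₀ * α₀ ^ 2)) with hc
  have hcpos : 0 < c := by positivity
  -- The main form yields `2pc₀s(X² + W²)`, and half of it absorbs the lower order terms once `L ≤
  -- pc₀s`. The factor `α₀²` in `c` converts `X = a₁g₁` back to `g₁`; the added ones ensure
  -- positivity.
  refine ⟨L / (p * c₀) + 1, by positivity, 2 * Q * C₀ + 1, by positivity, c, hcpos, ?_⟩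
  intro s hs a₁ a₂ α₁ α₂ q t χ w w' g₁ g₂ τ h1 h1A h2 h2A hK hK' hq hqQ ht hα₁ hα₂ hτ hχ htr
  have hs0 : 0 < s := lt_of_lt_of_le (by positivity) hs
  have hLs : L ≤ p * c₀ * s := by
    have : L / (p * c₀) ≤ s := by linarith
    rwa [div_le_iff₀' (by positivity)] at this
  have hpq : p ≤ q := by
    rw [hp, inv_le_iff_one_le_mul₀ hD]; exact hq
  have hq0 : 0 < q := hp0.trans_le hpq
  have ha₁ : 0 < a₁ := by linarith
  have ha₂ : 0 < a₂ := by linarith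
  have hχ0 : 0 ≤ χ := by rcases hχ with h | h <;> linarith [h]
  have hf := hform a₁ a₂ q t χ (a₁ * g₁) (s * w) h1 h2 h2A hK (by linarith) hq hqQ ht hχ
  have hKA : γ * a₂ - a₁ ≤ γ * A := by
    have : γ * a₂ ≤ γ * A := by gcongr
    linarith
  rw [interfaceDensity_eq htr]
  set K := γ * a₂ - a₁ with hKd
  have hK0 : 0 < K := by linarith
  set X := a₁ * g₁ with hX
  set W := s * w with hW
  have hX2 := sq_nonneg X
  have hW2 := sq_nonneg W
  -- lower order terms
  have hlow : W * (α₁ * a₁ * X + α₂ * a₂ * (-X - 2 * q * K * W)) + 4 * β * (q * K) * W ^ 2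
      ≤ L * (X ^ 2 + W ^ 2) :=
    lower_order_le hβ ha₁ h1A ha₂ h2A hα₁ hα₂ hq0 hqQ hK0 hKA
  have hlow2 := mul_le_mul_of_nonneg_right hLs (add_nonneg hX2 hW2)
  -- main terms
  have hmain : 2 * p * s * (c₀ * (X ^ 2 + W ^ 2)) - 2 * Q * s * (C₀ * (χ * W ^ 2))
      ≤ 2 * q * s * interfaceForm a₁ a₂ γ q (β ^ 2 * t ^ 2) X W := by
    have e1 := mul_le_mul_of_nonneg_left hf (show 0 ≤ 2 * q * s by positivity)
    have e2 : 2 * p * s * (c₀ * (X ^ 2 + W ^ 2)) ≤ 2 * q * s * (c₀ * (X ^ 2 + W ^ 2)) := by gcongr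
    have e3 : 2 * q * s * (C₀ * (χ * W ^ 2)) ≤ 2 * Q * s * (C₀ * (χ * W ^ 2)) := by gcongr
    linarith only [e1, e2, e3]
  have hwt : c * s * w' ^ 2 ≤ 2 * q * s * K * w' ^ 2 := by
    have : c ≤ 2 * p * δ := min_le_left _ _
    calc c * s * w' ^ 2 ≤ 2 * p * δ * s * w' ^ 2 := by gcongr
      _ ≤ 2 * q * K * s * w' ^ 2 := by gcongr
      _ = _ := by ring
  have hτ' : c * s * τ ≤ 2 * q * s * (a₁ ^ 2 - γ * a₂ ^ 2) * τ := by
    have : c ≤ 2 * p * δ := min_le_left _ _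
    calc c * s * τ ≤ 2 * p * δ * s * τ := by gcongr
      _ ≤ 2 * q * (a₁ ^ 2 - γ * a₂ ^ 2) * s * τ := by gcongr
      _ = _ := by ring
  have hWc : c * s * W ^ 2 ≤ p * c₀ * s * W ^ 2 := by
    have : c ≤ p * c₀ := (min_le_right _ _).trans (min_le_left _ _)
    gcongr
  have hgc : c * s * g₁ ^ 2 ≤ p * c₀ * s * X ^ 2 := by
    have : c ≤ p * c₀ * α₀ ^ 2 := (min_le_right _ _).trans (min_le_right _ _)
    calc c * s * g₁ ^ 2 ≤ p * c₀ * α₀ ^ 2 * s * g₁ ^ 2 := by gcongr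
      _ ≤ p * c₀ * a₁ ^ 2 * s * g₁ ^ 2 := by gcongr
      _ = _ := by rw [hX]; ring
  have hχW : 2 * Q * s * (C₀ * (χ * W ^ 2)) ≤ (2 * Q * C₀ + 1) * s ^ 3 * (χ * w ^ 2) := by
    have : 0 ≤ s ^ 3 * (χ * w ^ 2) := by positivity
    rw [hW]
    linarith only [this]
  have e5 : 4 * β * s ^ 2 * (q * K * (2 * t * w * w' + w ^ 2))
      = 8 * β * s ^ 2 * q * K * (t * w * w') + 4 * β * (q * K) * W ^ 2 := by rw [hW]; ring
  have e6 : c * s * (w' ^ 2 + s ^ 2 * w ^ 2 + τ + g₁ ^ 2)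
      = c * s * w' ^ 2 + c * s * W ^ 2 + c * s * τ + c * s * g₁ ^ 2 := by rw [hW]; ring
  have e7 : s * w * (α₁ * a₁ * X + α₂ * a₂ * (-X - 2 * q * K * W))
      = W * (α₁ * a₁ * X + α₂ * a₂ * (-X - 2 * q * K * W)) := rfl
  rw [e5, e6, e7]
  linarith only [hlow, hlow2, hmain, hwt, hτ', hWc, hgc, hχW]

end Algebra

/-! ### Boundary terms as integrals of pointwise densities -/

section Density

variable {d : ℕ}

/-- The sum of the integrands of the six boundary terms, in terms of the values of the coefficients
`a`, `α`, of `w`, `∂_t w`, `∂_t φ`, `∇φ = m`, `∇w = G` and of the normal `n`. -/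
noncomputable def boundaryDensity (a α s w w' φ' : ℝ) (m G n : EuclideanSpace ℝ (Fin d)) : ℝ :=
  -s * (w' ^ 2 * a * inner ℝ m n) + 2 * s * (a * inner ℝ G n * φ' * w')
    + -2 * s * (a ^ 2 * inner ℝ m G * inner ℝ G n) + s * (‖G‖ ^ 2 * a ^ 2 * inner ℝ m n)
    + -s * (α * a ^ 2 * inner ℝ G n * w)
    + s ^ 3 * (w ^ 2 * a * (φ' ^ 2 - a * ‖m‖ ^ 2) * inner ℝ m n)

theorem integral_add_six {X : Type*} [MeasurableSpace X] {μ : Measure X}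
    {f₁ f₂ f₃ f₄ f₅ f₆ : X → ℝ} (h₁ : Integrable f₁ μ) (h₂ : Integrable f₂ μ)
    (h₃ : Integrable f₃ μ) (h₄ : Integrable f₄ μ) (h₅ : Integrable f₅ μ) (h₆ : Integrable f₆ μ) :
    ∫ x, (f₁ x + f₂ x + f₃ x + f₄ x + f₅ x + f₆ x) ∂μ = ∫ x, f₁ x ∂μ + ∫ x, f₂ x ∂μ
      + ∫ x, f₃ x ∂μ + ∫ x, f₄ x ∂μ + ∫ x, f₅ x ∂μ + ∫ x, f₆ x ∂μ := by
  have h12 : Integrable (fun x => f₁ x + f₂ x) μ := h₁.add h₂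
  have h13 : Integrable (fun x => f₁ x + f₂ x + f₃ x) μ := h12.add h₃
  have h14 : Integrable (fun x => f₁ x + f₂ x + f₃ x + f₄ x) μ := h13.add h₄
  have h15 : Integrable (fun x => f₁ x + f₂ x + f₃ x + f₄ x + f₅ x) μ := h14.add h₅
  rw [integral_add h15 h₆, integral_add h14 h₅, integral_add h13 h₄, integral_add h12 h₃,
    integral_add h₁ h₂]

/-- On a finite measure, products of essentially bounded functions are integrable, which is what
allows the six integrals to be merged into one. -/
theorem sum_boundaryTerm {T : ℝ} {Γ U : Set (EuclideanSpace ℝ (Fin d))}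
    [IsFiniteMeasure (surfaceMeasure Γ)]
    {ν : EuclideanSpace ℝ (Fin d) → EuclideanSpace ℝ (Fin d)}
    {a α : EuclideanSpace ℝ (Fin d) → ℝ} (s : ℝ) {φ w : ℝ × EuclideanSpace ℝ (Fin d) → ℝ}
    (ha : MemLp (fun z => a z.2) ⊤ (lateralMeasure T Γ))
    (hα : MemLp (fun z => α z.2) ⊤ (lateralMeasure T Γ))
    (hν : MemLp (fun z => ν z.2) ⊤ (lateralMeasure T Γ))
    (hw : MemLp w ⊤ (lateralMeasure T Γ))
    (hw' : MemLp (timeDeriv T w) ⊤ (lateralMeasure T Γ))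
    (hφ' : MemLp (timeDeriv T φ) ⊤ (lateralMeasure T Γ))
    (hm : MemLp (spaceGrad U φ) ⊤ (lateralMeasure T Γ))
    (hG : MemLp (spaceGrad U w) ⊤ (lateralMeasure T Γ)) :
    Integrable (fun z => boundaryDensity (a z.2) (α z.2) s (w z) (timeDeriv T w z)
      (timeDeriv T φ z) (spaceGrad U φ z) (spaceGrad U w z) (ν z.2)) (lateralMeasure T Γ) ∧
    ∑ i, boundaryTerm T Γ U ν a α s φ w i = ∫ z, boundaryDensity (a z.2) (α z.2) s (w z)
      (timeDeriv T w z) (timeDeriv T φ z) (spaceGrad U φ z) (spaceGrad U w z) (ν z.2)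
      ∂(lateralMeasure T Γ) := by
  have hmn := memLp_top_inner hm hν
  have hGn := memLp_top_inner hG hν
  have hmG := memLp_top_inner hm hG
  have sq : ∀ {f : ℝ × EuclideanSpace ℝ (Fin d) → ℝ}, MemLp f ⊤ (lateralMeasure T Γ) →
      MemLp (fun z => f z ^ 2) ⊤ (lateralMeasure T Γ) := fun hf => by
    simpa only [pow_two] using memLp_top_mul hf hf
  have h1 := ((memLp_top_mul (memLp_top_mul (sq hw') ha) hmn).integrable le_top).const_mul (-s)
  have h2 := ((memLp_top_mul (memLp_top_mul (memLp_top_mul ha hGn) hφ') hw').integrable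
    le_top).const_mul (2 * s)
  have h3 := ((memLp_top_mul (memLp_top_mul (sq ha) hmG) hGn).integrable le_top).const_mul (-2 * s)
  have h4 := ((memLp_top_mul (memLp_top_mul (sq hG.norm) (sq ha)) hmn).integrable
    le_top).const_mul s
  have h5 := ((memLp_top_mul (memLp_top_mul (memLp_top_mul hα (sq ha)) hGn) hw).integrable
    le_top).const_mul (-s)
  have h6 := ((memLp_top_mul (memLp_top_mul (memLp_top_mul (sq hw) ha)
    ((sq hφ').sub (memLp_top_mul ha (sq hm.norm)))) hmn).integrable le_top).const_mul (s ^ 3)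
  refine ⟨((((h1.add h2).add h3).add h4).add h5).add h6, ?_⟩
  refine Eq.trans ?_ (integral_add_six h1 h2 h3 h4 h5 h6).symm
  simp only [integral_const_mul]
  simp only [boundaryTerm, Fin.sum_univ_six, normalDeriv]
  rfl

/-- Under the interface conditions, the two boundary densities add up to the interface density. -/
theorem boundaryDensity_add {a₁ a₂ α₁ α₂ γ q β t s w w' : ℝ} {n G₁ G₂ : EuclideanSpace ℝ (Fin d)}
    (hn : ‖n‖ = 1) (hτ : ∀ τ, inner ℝ n τ = 0 → inner ℝ G₁ τ = inner ℝ G₂ τ) :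
    boundaryDensity a₁ α₁ s w w' (-2 * β * t) ((2 * q) • n) G₁ n
      + boundaryDensity a₂ α₂ s w w' (-2 * β * t) ((2 * γ * q) • n) G₂ (-n)
      = interfaceDensity a₁ a₂ α₁ α₂ γ q β t s w w' (inner ℝ G₁ n) (inner ℝ G₂ (-n))
        (‖G₁ - (inner ℝ G₁ n : ℝ) • n‖ ^ 2) := by
  have hnn : inner ℝ n n = (1 : ℝ) := by rw [real_inner_self_eq_norm_sq, hn, one_pow]
  have hdec : ∀ G : EuclideanSpace ℝ (Fin d),
      ‖G‖ ^ 2 = ‖G - (inner ℝ G n : ℝ) • n‖ ^ 2 + inner ℝ G n ^ 2 := by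
    intro G
    rw [norm_sub_sq_real, inner_smul_right, norm_smul, hn, Real.norm_eq_abs, mul_one, sq_abs]
    ring
  -- Equality of the tangential parts is tested against the tangential projection of an arbitrary
  -- vector `y`.
  have heq : G₁ - (inner ℝ G₁ n : ℝ) • n = G₂ - (inner ℝ G₂ n : ℝ) • n := by
    refine ext_inner_right ℝ fun y => ?_
    have h := hτ (y - (inner ℝ n y : ℝ) • n) (by
      rw [inner_sub_right, inner_smul_right, hnn]; ring)
    simp only [inner_sub_right, inner_smul_right] at h
    simp only [inner_sub_left, inner_smul_left, conj_trivial]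
    linarith
  have hG₁ := hdec G₁
  have hG₂ := hdec G₂
  rw [← heq] at hG₂
  simp only [boundaryDensity, interfaceDensity, inner_smul_left, inner_smul_right,
    inner_neg_right, conj_trivial, hnn,
    norm_smul, hn, hG₁, hG₂, Real.norm_eq_abs, mul_one, sq_abs, real_inner_comm n]
  ring

end Density

/-! ### The cross term: integration by parts in time -/

section TimeIntegration

variable {d : ℕ} {Γ : Set (EuclideanSpace ℝ (Fin d))} {T : ℝ}

/-- Integration by parts in time: `2 t w ∂_t w + w² = ∂_t (t w²)`. -/
theorem integral_time_nonneg (hT : 0 < T) {w w' : ℝ → ℝ} (hw : ContinuousOn w (Icc (-T) T))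
    (hw' : ContinuousOn w' (Icc (-T) T)) (hd : ∀ t ∈ Ioo (-T) T, HasDerivAt w (w' t) t) :
    0 ≤ ∫ t in Ioo (-T) T, (2 * t * w t * w' t + w t ^ 2) := by
  have hle : -T ≤ T := by linarith
  have hcont : ContinuousOn (fun t => 2 * t * w t * w' t + w t ^ 2) (Icc (-T) T) := by fun_prop
  rw [← integral_Ioc_eq_integral_Ioo, ← intervalIntegral.integral_of_le hle,
    intervalIntegral.integral_eq_sub_of_hasDerivAt_of_le (f := fun t => t * w t ^ 2) hle]
  · have : T * w T ^ 2 - -T * w (-T) ^ 2 = T * (w T ^ 2 + w (-T) ^ 2) := by ring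
    rw [this]
    positivity
  · fun_prop
  · intro t ht
    have := (hasDerivAt_id t).mul ((hd t ht).pow 2)
    refine this.congr_deriv ?_
    simp
    ring
  · exact hcont.intervalIntegrable_of_Icc hle

/-- By Fubini the time integral is taken first, at fixed `x`, where the nonnegative factor `k x` is
a constant. -/
theorem integral_lateralMeasure_time_nonneg [IsFiniteMeasure (surfaceMeasure Γ)]
    (hΓ : IsCompact Γ) (hT : 0 < T) {k : EuclideanSpace ℝ (Fin d) → ℝ}
    {w w' : ℝ × EuclideanSpace ℝ (Fin d) → ℝ}
    (hk : MemLp (fun z => k z.2) ⊤ (lateralMeasure T Γ)) (hk0 : ∀ x ∈ Γ, 0 ≤ k x)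
    (hw : ContinuousOn w (Icc (-T) T ×ˢ Γ)) (hw' : ContinuousOn w' (Icc (-T) T ×ˢ Γ))
    (hd : ∀ z ∈ Ioo (-T) T ×ˢ Γ, HasDerivAt (fun t => w (t, z.2)) (w' z) z.1) :
    Integrable (fun z => k z.2 * (2 * z.1 * w z * w' z + w z ^ 2)) (lateralMeasure T Γ) ∧
    0 ≤ ∫ z, k z.2 * (2 * z.1 * w z * w' z + w z ^ 2) ∂(lateralMeasure T Γ) := by
  have hcont : ContinuousOn (fun z : ℝ × EuclideanSpace ℝ (Fin d) =>
      2 * z.1 * w z * w' z + w z ^ 2) (Icc (-T) T ×ˢ Γ) := by fun_prop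
  have hint := (memLp_top_mul hk (memLp_top_of_continuousOn hΓ hcont)).integrable le_top
  refine ⟨hint, ?_⟩
  unfold lateralMeasure at hint ⊢
  rw [integral_prod_symm _ hint]
  refine integral_nonneg_of_ae ?_
  have hΓae : ∀ᵐ x ∂(surfaceMeasure Γ), x ∈ Γ := ae_restrict_mem hΓ.measurableSet
  filter_upwards [hΓae] with x hx
  simp only [integral_const_mul, Pi.zero_apply]
  have hmaps : MapsTo (fun t : ℝ => (t, x)) (Icc (-T) T) (Icc (-T) T ×ˢ Γ) := fun t ht => ⟨ht, hx⟩
  have hc : ContinuousOn (fun t : ℝ => (t, x)) (Icc (-T) T) := by fun_prop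
  exact mul_nonneg (hk0 x hx) (integral_time_nonneg hT (hw.comp hc hmaps) (hw'.comp hc hmaps)
    fun t ht => hd (t, x) ⟨ht, hx⟩)

end TimeIntegration

/-! ### Regularity of the conjugated functions on the interface -/

section ConjugateTraces

variable {d : ℕ} {Γ U Ω : Set (EuclideanSpace ℝ (Fin d))} {T β s M : ℝ}
  {v : ℝ × EuclideanSpace ℝ (Fin d) → ℝ} {μ : EuclideanSpace ℝ (Fin d) → ℝ}
  {m : EuclideanSpace ℝ (Fin d) → EuclideanSpace ℝ (Fin d)}

theorem continuousOn_exp_weight (hμ : ∀ x ∈ Γ, μ x = M) :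
    ContinuousOn (fun z => Real.exp (s * weight β μ z)) (Icc (-T) T ×ˢ Γ) := by
  have : ContinuousOn (fun z : ℝ × EuclideanSpace ℝ (Fin d) => Real.exp (s * (M - β * z.1 ^ 2)))
      (Icc (-T) T ×ˢ Γ) := by fun_prop
  exact this.congr fun z hz => by simp only [weight, hμ z.2 hz.2]

theorem continuousOn_conjugate (hΓ : Γ ⊆ closure U ∩ Ω) (hμ : ∀ x ∈ Γ, μ x = M)
    (hv : ContDiffOn ℝ 1 v (Icc (-T) T ×ˢ closure U)) :
    ContinuousOn (conjugate s (weight β μ) v) (Icc (-T) T ×ˢ Γ) :=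
  (continuousOn_exp_weight hμ).mul
    (hv.continuousOn.mono (prod_mono_right (hΓ.trans inter_subset_left)))

theorem continuousOn_timeDeriv_conjugate (hT : 0 < T) (hU : UniqueDiffOn ℝ (closure U ∩ Ω))
    (hΓ : Γ ⊆ closure U ∩ Ω) (hμ : ∀ x ∈ Γ, μ x = M)
    (hv : ContDiffOn ℝ 1 v (Icc (-T) T ×ˢ closure U)) :
    ContinuousOn (timeDeriv T (conjugate s (weight β μ) v)) (Icc (-T) T ×ˢ Γ) := by
  have h1 := (continuousOn_timeDeriv hT hU hv).mono (prod_mono_right hΓ)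
  have h2 := hv.continuousOn.mono (prod_mono_right (s := Icc (-T) T) (hΓ.trans inter_subset_left))
  have h3 := continuousOn_exp_weight (s := s) (β := β) (T := T) hμ
  refine ContinuousOn.congr ?_ fun z hz =>
    (hasDerivWithinAt_conjugate hT hv ⟨hz.1, hΓ hz.2⟩).2
  refine h3.mul (h1.add (ContinuousOn.mul ?_ h2))
  fun_prop

theorem memLp_spaceGrad_conjugate [IsFiniteMeasure (surfaceMeasure Γ)] (hΓc : IsCompact Γ)
    (hT : 0 < T) (hΩ : IsOpen Ω) (hU : UniqueDiffOn ℝ (closure U ∩ Ω))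
    (hΓ : Γ ⊆ closure U ∩ Ω) (hμ : ∀ x ∈ Γ, μ x = M)
    (hm : ∀ x ∈ Γ, HasGradientWithinAt μ (m x) (closure U) x)
    (hmL : MemLp (fun z => m z.2) ⊤ (lateralMeasure T Γ))
    (hv : ContDiffOn ℝ 1 v (Icc (-T) T ×ˢ closure U)) :
    MemLp (spaceGrad U (conjugate s (weight β μ) v)) ⊤ (lateralMeasure T Γ) := by
  have h1 := (continuousOn_spaceGrad hT hΩ hU hv).mono (prod_mono_right hΓ)
  have h2 := hv.continuousOn.mono (prod_mono_right (s := Icc (-T) T) (hΓ.trans inter_subset_left))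
  have h3 := continuousOn_exp_weight (s := s) (β := β) (T := T) hμ
  have h4 := (memLp_top_of_continuousOn hΓc h1).add
    (hmL.smul (memLp_top_of_continuousOn hΓc (continuousOn_const (c := s) |>.mul h2)) (r := ⊤))
  have h5 := h4.smul (memLp_top_of_continuousOn hΓc h3) (r := ⊤)
  refine h5.ae_eq ?_
  filter_upwards [ae_lateralMeasure hΓc.measurableSet] with z hz
  exact (spaceGrad_conjugate hΩ hU hv ⟨Ioo_subset_Icc_self hz.1, hΓ hz.2⟩ (hm z.2 hz.2)).symm

theorem memLp_timeDeriv_weight [IsFiniteMeasure (surfaceMeasure Γ)] (hΓc : IsCompact Γ)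
    (hT : 0 < T) : MemLp (timeDeriv T (weight β μ)) ⊤ (lateralMeasure T Γ) := by
  have : ContinuousOn (fun z : ℝ × EuclideanSpace ℝ (Fin d) => -2 * β * z.1)
      (Icc (-T) T ×ˢ Γ) := by fun_prop
  refine (memLp_top_of_continuousOn hΓc this).ae_eq ?_
  filter_upwards [ae_lateralMeasure hΓc.measurableSet] with z hz
  exact (timeDeriv_weight hT (Ioo_subset_Icc_self hz.1)).symm

theorem memLp_spaceGrad_weight [IsFiniteMeasure (surfaceMeasure Γ)] (hΓc : IsCompact Γ)
    (hU : UniqueDiffOn ℝ (closure U ∩ Ω)) (hΓ : Γ ⊆ closure U ∩ Ω)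
    (hm : ∀ x ∈ Γ, HasGradientWithinAt μ (m x) (closure U) x)
    (hmL : MemLp (fun z => m z.2) ⊤ (lateralMeasure T Γ)) :
    MemLp (spaceGrad U (weight β μ)) ⊤ (lateralMeasure T Γ) := by
  refine hmL.ae_eq ?_
  filter_upwards [ae_lateralMeasure hΓc.measurableSet] with z hz
  exact (spaceGrad_weight ((hU z.2 (hΓ hz.2)).mono inter_subset_left) (hm z.2 hz.2)).symm

end ConjugateTraces

/-! ### Measurable normals, unique differentiability and uniform bounds at the interface -/

section Interface

variable {d : ℕ} {Ω Ω₁ Γ : Set (EuclideanSpace ℝ (Fin d))} {x₁ : EuclideanSpace ℝ (Fin d)} {T : ℝ}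

theorem memLp_minkowskiSlope [IsFiniteMeasure (surfaceMeasure Γ)] (ho : IsOpen Ω₁)
    (hc : Convex ℝ Ω₁) (hx₁ : x₁ ∈ Ω₁) :
    MemLp (fun z => minkowskiSlope Ω₁ x₁ z.2) ⊤ (lateralMeasure T Γ) := by
  obtain ⟨K, hK⟩ := exists_lipschitzWith_minkowski ho hc hx₁
  refine memLp_top_of_bound ?_ K (Eventually.of_forall fun z => ?_)
  · exact ((measurable_gradient_minkowski Ω₁ x₁).norm.comp measurable_snd).aestronglyMeasurable
  · have h0 : 0 ≤ minkowskiSlope Ω₁ x₁ z.2 := norm_nonneg _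
    rw [Real.norm_of_nonneg h0]
    exact minkowskiSlope_le hK

/-- The normal is defined by choice, so measurability is not visible from its definition; on the
boundary it coincides with the normalized gradient of the Minkowski functional, which is measurable.
-/
theorem memLp_outwardNormal {k : WithTop ℕ∞} (hk : 1 ≤ k)
    [IsFiniteMeasure (surfaceMeasure (frontier Ω₁))] (ho : IsOpen Ω₁)
    (hc : Convex ℝ Ω₁) (hU : HasCkBoundary k Ω₁) (hx₁ : x₁ ∈ Ω₁) :
    MemLp (fun z => outwardNormal Ω₁ z.2) ⊤ (lateralMeasure T (frontier Ω₁)) := by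
  have hae := ae_lateralMeasure (T := T) (isClosed_frontier (s := Ω₁)).measurableSet
  have hmeas : Measurable fun z : ℝ × EuclideanSpace ℝ (Fin d) =>
      (minkowskiSlope Ω₁ x₁ z.2)⁻¹ • gradient (minkowski Ω₁ x₁) z.2 :=
    ((measurable_gradient_minkowski Ω₁ x₁).norm.inv.smul
      (measurable_gradient_minkowski Ω₁ x₁)).comp measurable_snd
  refine memLp_top_of_bound (hmeas.aestronglyMeasurable.congr ?_) 1 ?_
  · filter_upwards [hae] with z hz
    obtain ⟨h0, -, h1⟩ := hasGradientAt_minkowski hk ho hc hU hx₁ hz.2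
    rw [h1.gradient, smul_smul, inv_mul_cancel₀ h0.ne', one_smul]
  · filter_upwards [hae] with z hz
    exact (exists_hasGradientAt_minkowski hk ho hc hU hx₁ hz.2).1.le

theorem frontier_subset_closure_diff {k : WithTop ℕ∞} (hk : 1 ≤ k) (hΩ : IsOpen Ω)
    (ho : IsOpen Ω₁) (hc : Convex ℝ Ω₁) (hU : HasCkBoundary k Ω₁) (hx₁ : x₁ ∈ Ω₁)
    (hsub : closure Ω₁ ⊆ Ω) : frontier Ω₁ ⊆ closure (Ω \ closure Ω₁) ∩ Ω := fun x hx => by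
  obtain ⟨h1, h2, -⟩ := exists_hasGradientAt_minkowski hk ho hc hU hx₁ hx
  have hxΩ := hsub (frontier_subset_closure hx)
  exact ⟨(uniqueDiffWithinAt_diff_closure hΩ hxΩ h1 h2).2, hxΩ⟩

theorem uniqueDiffOn_closure_inter (ho : IsOpen Ω₁) (hc : Convex ℝ Ω₁) (hx₁ : x₁ ∈ Ω₁)
    (hsub : closure Ω₁ ⊆ Ω) : UniqueDiffOn ℝ (closure Ω₁ ∩ Ω) := by
  rw [inter_eq_left.2 hsub]
  exact uniqueDiffOn_convex hc.closure
    ⟨x₁, interior_mono subset_closure (by rwa [ho.interior_eq])⟩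

/-- A point of this set is either on the interface, where the supporting half-space applies, or
interior to `Ω \ closure Ω₁`. -/
theorem uniqueDiffOn_closure_diff_inter {k : WithTop ℕ∞} (hk : 1 ≤ k) (hΩ : IsOpen Ω)
    (ho : IsOpen Ω₁) (hc : Convex ℝ Ω₁) (hU : HasCkBoundary k Ω₁) (hx₁ : x₁ ∈ Ω₁) :
    UniqueDiffOn ℝ (closure (Ω \ closure Ω₁) ∩ Ω) := by
  intro x hx
  have hsub : Ω \ closure Ω₁ ⊆ closure (Ω \ closure Ω₁) ∩ Ω := fun y hy =>
    ⟨subset_closure hy, hy.1⟩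
  by_cases hxc : x ∈ closure Ω₁
  · have hx1 : x ∉ Ω₁ := fun h => by
      obtain ⟨y, hy1, hy2⟩ := mem_closure_iff.1 hx.1 Ω₁ ho h
      exact hy2.2 (subset_closure hy1)
    have hxf : x ∈ frontier Ω₁ := by
      rw [ho.frontier_eq]
      exact ⟨hxc, hx1⟩
    obtain ⟨h1, h2, -⟩ := exists_hasGradientAt_minkowski hk ho hc hU hx₁ hxf
    exact (uniqueDiffWithinAt_diff_closure hΩ hx.2 h1 h2).1.mono hsub
  · exact ((hΩ.sdiff isClosed_closure).uniqueDiffWithinAt ⟨hx.2, hxc⟩).mono hsub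

/-- Bounds that hold on an open set persist up to its boundary. -/
theorem bounds_closure {U : Set (EuclideanSpace ℝ (Fin d))} {a : EuclideanSpace ℝ (Fin d) → ℝ}
    {l u : ℝ} (h : ∀ x ∈ U, l ≤ a x ∧ a x ≤ u) (ha : ContinuousOn a (closure U)) :
    ∀ x ∈ closure U, l ≤ a x ∧ a x ≤ u := fun x hx => by
  have := MapsTo.closure_of_continuousOn (t := Icc l u) (fun y hy => h y hy) ha hx
  rwa [isClosed_Icc.closure_eq] at this

/-- Compactness turns the jump conditions into uniform ones. -/
theorem exists_uniform_jump (hΓ : IsCompact Γ) {a₁ a₂ : EuclideanSpace ℝ (Fin d) → ℝ} {γ : ℝ}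
    (ha₁ : ContinuousOn a₁ Γ) (ha₂ : ContinuousOn a₂ Γ) (hpos : ∀ x ∈ Γ, 0 < a₂ x)
    (hjump : ∀ x ∈ Γ, a₁ x / a₂ x < γ ∧ γ < (a₁ x / a₂ x) ^ 2) :
    ∃ δ > 0, ∀ x ∈ Γ, δ ≤ γ * a₂ x - a₁ x ∧ δ ≤ a₁ x ^ 2 - γ * a₂ x ^ 2 := by
  obtain ⟨δ₁, h1, h1'⟩ := hΓ.exists_forall_le' (f := fun x => γ * a₂ x - a₁ x) (by fun_prop)
    (a := 0) fun x hx => by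
      have := (hjump x hx).1
      rw [div_lt_iff₀ (hpos x hx)] at this
      linarith
  obtain ⟨δ₂, h2, h2'⟩ := hΓ.exists_forall_le' (f := fun x => a₁ x ^ 2 - γ * a₂ x ^ 2)
    (by fun_prop) (a := 0) fun x hx => by
      have := (hjump x hx).2
      have h := hpos x hx
      rw [div_pow, lt_div_iff₀ (by positivity)] at this
      linarith
  exact ⟨min δ₁ δ₂, lt_min h1 h2, fun x hx =>
    ⟨(min_le_left _ _).trans (h1' x hx), (min_le_right _ _).trans (h2' x hx)⟩⟩

theorem timeDeriv_congr_of_eqOn {v₁ v₂ : ℝ × EuclideanSpace ℝ (Fin d) → ℝ}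
    (h : ∀ z ∈ Ioo (-T) T ×ˢ Γ, v₁ z = v₂ z) {z : ℝ × EuclideanSpace ℝ (Fin d)}
    (hz : z ∈ Ioo (-T) T ×ˢ Γ) : timeDeriv T v₁ z = timeDeriv T v₂ z := by
  refine EventuallyEq.derivWithin_eq ?_ (h z hz)
  filter_upwards [nhdsWithin_le_nhds (Ioo_mem_nhds hz.1.1 hz.1.2)] with t ht
  exact h (t, z.2) ⟨ht, hz.2⟩

end Interface

/-! ### Interface conditions for the conjugated functions -/

section Pointwise

variable {d : ℕ} {Ω U₁ U₂ : Set (EuclideanSpace ℝ (Fin d))} {x₁ : EuclideanSpace ℝ (Fin d)} {T : ℝ}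

/-- At a point of the interface, the boundary densities of the conjugated functions on the two
sides add up to the interface density, and the transmission conditions pass to the conjugated
functions. -/
theorem boundaryDensity_add_conjugate {k : WithTop ℕ∞} (hk : 1 ≤ k) (hT : 0 < T) (hΩ : IsOpen Ω)
    (ho : IsOpen U₁) (hc : Convex ℝ U₁) (hC : HasCkBoundary k U₁) (hx₁ : x₁ ∈ U₁)
    (hU₁ : UniqueDiffOn ℝ (closure U₁ ∩ Ω)) (hU₂ : UniqueDiffOn ℝ (closure U₂ ∩ Ω))
    (hΓ₁ : frontier U₁ ⊆ closure U₁ ∩ Ω) (hΓ₂ : frontier U₁ ⊆ closure U₂ ∩ Ω)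
    {μ₁ μ₂ : EuclideanSpace ℝ (Fin d) → ℝ} {q γ β s M : ℝ}
    {a₁ a₂ α₁ α₂ : ℝ} {v₁ v₂ : ℝ × EuclideanSpace ℝ (Fin d) → ℝ}
    (hv₁ : ContDiffOn ℝ 1 v₁ (Icc (-T) T ×ˢ closure U₁))
    (hv₂ : ContDiffOn ℝ 1 v₂ (Icc (-T) T ×ˢ closure U₂))
    (hv : ∀ z ∈ Ioo (-T) T ×ˢ frontier U₁, v₁ z = v₂ z)
    (hμ₁ : ∀ x ∈ frontier U₁, μ₁ x = M) (hμ₂ : ∀ x ∈ frontier U₁, μ₂ x = M)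
    {z : ℝ × EuclideanSpace ℝ (Fin d)} (hz : z ∈ Ioo (-T) T ×ˢ frontier U₁)
    (hm₁ : HasGradientWithinAt μ₁ ((2 * q) • outwardNormal U₁ z.2) (closure U₁) z.2)
    (hm₂ : HasGradientWithinAt μ₂ ((2 * γ * q) • outwardNormal U₁ z.2) (closure U₂) z.2)
    (htr : a₁ * normalDeriv U₁ (outwardNormal U₁) v₁ z
      + a₂ * normalDeriv U₂ (fun x => -outwardNormal U₁ x) v₂ z = 0) :
    boundaryDensity a₁ α₁ s (conjugate s (weight β μ₁) v₁ z)
        (timeDeriv T (conjugate s (weight β μ₁) v₁) z) (timeDeriv T (weight β μ₁) z)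
        (spaceGrad U₁ (weight β μ₁) z) (spaceGrad U₁ (conjugate s (weight β μ₁) v₁) z)
        (outwardNormal U₁ z.2)
      + boundaryDensity a₂ α₂ s (conjugate s (weight β μ₂) v₂ z)
        (timeDeriv T (conjugate s (weight β μ₂) v₂) z) (timeDeriv T (weight β μ₂) z)
        (spaceGrad U₂ (weight β μ₂) z) (spaceGrad U₂ (conjugate s (weight β μ₂) v₂) z)
        (-outwardNormal U₁ z.2)
      = interfaceDensity a₁ a₂ α₁ α₂ γ q β z.1 s (conjugate s (weight β μ₁) v₁ z)
        (timeDeriv T (conjugate s (weight β μ₁) v₁) z)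
        (normalDeriv U₁ (outwardNormal U₁) (conjugate s (weight β μ₁) v₁) z)
        (normalDeriv U₂ (fun x => -outwardNormal U₁ x) (conjugate s (weight β μ₂) v₂) z)
        (‖tangentialGrad U₁ (outwardNormal U₁) (conjugate s (weight β μ₁) v₁) z‖ ^ 2) ∧
    a₁ * (normalDeriv U₁ (outwardNormal U₁) (conjugate s (weight β μ₁) v₁) z
        - 2 * q * s * conjugate s (weight β μ₁) v₁ z)
      + a₂ * (normalDeriv U₂ (fun x => -outwardNormal U₁ x) (conjugate s (weight β μ₂) v₂) z
        + 2 * γ * q * s * conjugate s (weight β μ₁) v₁ z) = 0 := by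
  have hn := (exists_hasGradientAt_minkowski hk ho hc hC hx₁ hz.2).1
  have hzc := Ioo_subset_Icc_self hz.1
  have hz₁ : z ∈ Icc (-T) T ×ˢ (closure U₁ ∩ Ω) := ⟨hzc, hΓ₁ hz.2⟩
  have hz₂ : z ∈ Icc (-T) T ×ˢ (closure U₂ ∩ Ω) := ⟨hzc, hΓ₂ hz.2⟩
  have hwt : weight β μ₁ z = weight β μ₂ z := by
    simp only [weight, hμ₁ z.2 hz.2, hμ₂ z.2 hz.2]
  have hw : ∀ y ∈ Ioo (-T) T ×ˢ frontier U₁,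
      conjugate s (weight β μ₂) v₂ y = conjugate s (weight β μ₁) v₁ y := fun y hy => by
    simp only [conjugate, weight, hμ₁ y.2 hy.2, hμ₂ y.2 hy.2, hv y hy]
  have hG₁ := spaceGrad_conjugate (β := β) (s := s) hΩ hU₁ hv₁ hz₁ hm₁
  have hG₂ := spaceGrad_conjugate (β := β) (s := s) hΩ hU₂ hv₂ hz₂ hm₂
  rw [← hwt, ← hv z hz] at hG₂
  have hτ : ∀ τ, inner ℝ (outwardNormal U₁ z.2) τ = 0 →
      inner ℝ (spaceGrad U₁ (conjugate s (weight β μ₁) v₁) z) τ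
        = inner ℝ (spaceGrad U₂ (conjugate s (weight β μ₂) v₂) z) τ := by
    intro τ hτ
    have h := inner_gradient_eq_of_eqOn_frontier hk ho hc hC hx₁ hz.2
      (hΓ₁.trans inter_subset_left) (hΓ₂.trans inter_subset_left)
      (hasGradientWithinAt_spaceGrad hΩ hU₁ hv₁ hz₁).1
      (hasGradientWithinAt_spaceGrad hΩ hU₂ hv₂ hz₂).1 (fun x hx => hv (z.1, x) ⟨hz.1, hx⟩) hτ
    -- Both weight gradients are normal, so tangentially conjugation only multiplies by the common
    -- exponential factor.
    rw [hG₁, hG₂]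
    simp only [inner_smul_left, inner_add_left, hτ, h, mul_zero]
  constructor
  · rw [hw z hz, timeDeriv_congr_of_eqOn hw hz, timeDeriv_weight hT hzc, timeDeriv_weight hT hzc,
      spaceGrad_weight ((hU₁ z.2 hz₁.2).mono inter_subset_left) hm₁,
      spaceGrad_weight ((hU₂ z.2 hz₂.2).mono inter_subset_left) hm₂]
    exact boundaryDensity_add hn hτ
  · have hnn : inner ℝ (outwardNormal U₁ z.2) (outwardNormal U₁ z.2) = (1 : ℝ) := by
      rw [real_inner_self_eq_norm_sq, hn, one_pow]
    simp only [normalDeriv] at htr ⊢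
    rw [hG₁, hG₂]
    simp only [inner_smul_left, inner_add_left, inner_neg_right, conj_trivial, hnn,
      conjugate] at htr ⊢
    linear_combination Real.exp (s * weight β μ₁ z) * htr

end Pointwise

end InterfaceCarleman

/-! ### The interface estimate -/

open InterfaceCarleman in
theorem proposition2p3 {d : ℕ} (hd : 2 ≤ d)
    -- the geometry
    (Ω Ω₁ Ω₂ : Set (EuclideanSpace ℝ (Fin d)))
    (hΩ : IsOpen Ω) (hΩb : Bornology.IsBounded Ω) (hΩs : HasCkBoundary ∞ Ω)
    (hΩ₁ : IsStrictlyConvexDomain Ω₁) (hΩ₁s : HasCkBoundary 3 Ω₁)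
    (hΩ₁Ω : closure Ω₁ ⊆ Ω) (hΩ₂ : Ω₂ = Ω \ closure Ω₁)
    (T : ℝ) (hT : 0 < T)
    -- the main coefficient: bounds, regularity and jump conditions
    (a₁ a₂ : EuclideanSpace ℝ (Fin d) → ℝ) (α₀ α₁ γ : ℝ)
    (hα₀ : 0 < α₀) (hα₀α₁ : α₀ ≤ α₁)
    (ha₁b : ∀ x ∈ Ω₁, α₀ ≤ a₁ x ∧ a₁ x ≤ α₁)
    (ha₂b : ∀ x ∈ Ω₂, α₀ ≤ a₂ x ∧ a₂ x ≤ α₁)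
    (ha₁ : ContDiffOn ℝ 2 a₁ (closure Ω₁)) (ha₂ : ContDiffOn ℝ 2 a₂ (closure Ω₂))
    (hγ : 1 < γ)
    (hjump : ∀ x ∈ frontier Ω₁, a₁ x / a₂ x < γ ∧ γ < (a₁ x / a₂ x) ^ 2)
    -- the weight
    (x₁ : EuclideanSpace ℝ (Fin d)) (hx₁ : x₁ ∈ Ω₁)
    (η : EuclideanSpace ℝ (Fin d) → ℝ) (ε₁ ε : ℝ) (hη : IsCutoff Ω₁ x₁ ε₁ ε η)
    (M₁ : ℝ) (hM₁ : γ - 1 < M₁)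
    (β : ℝ) (hβ : 0 < β) (hβ' : β < 2 * α₀ / (Metric.diam Ω ^ 2 * (1 + M₁)))
    -- the auxiliary coefficient of the operator `P₂`, regular in each subdomain
    (α_in α_out : EuclideanSpace ℝ (Fin d) → ℝ)
    (hα_in : ContinuousOn α_in (closure Ω₁)) (hα_out : ContinuousOn α_out (closure Ω₂))
    -- notation: the interface, its normal exterior to `Ω₁`, and the weight with its two pieces
    (Γ : Set (EuclideanSpace ℝ (Fin d))) (hΓ : Γ = frontier Ω₁)
    (ν₁ ν₂ : EuclideanSpace ℝ (Fin d) → EuclideanSpace ℝ (Fin d))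
    (hν₁ : ν₁ = outwardNormal Ω₁) (hν₂ : ν₂ = fun x => -ν₁ x)
    (φ φ₁ φ₂ : ℝ × EuclideanSpace ℝ (Fin d) → ℝ)
    (hφ : φ = weight β (spatialWeight Ω₁ x₁ η γ M₁))
    (hφ₁ : φ₁ = weight β (innerWeight Ω₁ x₁ η M₁))
    (hφ₂ : φ₂ = weight β (outerWeight Ω₁ x₁ γ M₁)) :
    ∃ s₀ > 0, ∃ C > 0, ∃ c > 0, ∀ s ≥ s₀,
      ∀ v₁ v₂ w₁ w₂ : ℝ × EuclideanSpace ℝ (Fin d) → ℝ,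
        ContDiffOn ℝ 1 v₁ (Icc (-T) T ×ˢ closure Ω₁) →
        ContDiffOn ℝ 1 v₂ (Icc (-T) T ×ˢ closure Ω₂) →
        -- the transmission conditions
        (∀ z ∈ Ioo (-T) T ×ˢ Γ, v₁ z = v₂ z ∧
          a₁ z.2 * normalDeriv Ω₁ ν₁ v₁ z + a₂ z.2 * normalDeriv Ω₂ ν₂ v₂ z = 0) →
        w₁ = conjugate s φ₁ v₁ → w₂ = conjugate s φ₂ v₂ →
        -- `w₁` (which equals `w₂`) is the trace of `w` on the interface
        (-(C * s ^ 3 * (∫ z in {z | z ∈ Ioo (-T) T ×ˢ Γ ∧ φ z < 0}, w₁ z ^ 2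
              ∂(lateralMeasure T Γ)))
            - C * s ^ 2 * (∫ x, (w₁ (T, x) ^ 2 + w₁ (-T, x) ^ 2) ∂(surfaceMeasure Γ))
          ≤ ∑ i, (boundaryTerm T Γ Ω₁ ν₁ a₁ α_in s φ₁ w₁ i
              + boundaryTerm T Γ Ω₂ ν₂ a₂ α_out s φ₂ w₂ i)) ∧
        (c * s * (∫ z, (timeDeriv T w₁ z ^ 2 + s ^ 2 * w₁ z ^ 2
                + ‖tangentialGrad Ω₁ ν₁ w₁ z‖ ^ 2 + normalDeriv Ω₁ ν₁ w₁ z ^ 2)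
              ∂(lateralMeasure T Γ))
            - C * s ^ 3 * (∫ z in {z | z ∈ Ioo (-T) T ×ˢ Γ ∧ φ z < 0}, w₁ z ^ 2
              ∂(lateralMeasure T Γ))
            - C * s ^ 2 * (∫ x, (w₁ (T, x) ^ 2 + w₁ (-T, x) ^ 2) ∂(surfaceMeasure Γ))
          ≤ ∑ i, (boundaryTerm T Γ Ω₁ ν₁ a₁ α_in s φ₁ w₁ i
              + boundaryTerm T Γ Ω₂ ν₂ a₂ α_out s φ₂ w₂ i)) := by
  have hk : (1 : WithTop ℕ∞) ≤ 3 := by norm_num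
  have ho := hΩ₁.isOpen
  have hc := hΩ₁.convex
  subst hΓ hΩ₂ hν₁ hν₂
  have hb₁ : Bornology.IsBounded Ω₁ := hΩb.subset (subset_closure.trans hΩ₁Ω)
  have hΓc : IsCompact (frontier Ω₁) := Metric.isCompact_of_isClosed_isBounded isClosed_frontier
    (hb₁.closure.subset frontier_subset_closure)
  have := isFiniteMeasure_surfaceMeasure (by omega) ho hc hb₁ hΩ₁.nonempty
  have hae := ae_lateralMeasure (T := T) hΓc.measurableSet
  have hU₁ := uniqueDiffOn_closure_inter ho hc hx₁ hΩ₁Ω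
  have hU₂ := uniqueDiffOn_closure_diff_inter hk hΩ ho hc hΩ₁s hx₁
  have hΓ₁ : frontier Ω₁ ⊆ closure Ω₁ ∩ Ω := fun x hx =>
    ⟨frontier_subset_closure hx, hΩ₁Ω (frontier_subset_closure hx)⟩
  have hΓ₂ := frontier_subset_closure_diff hk hΩ ho hc hΩ₁s hx₁ hΩ₁Ω
  have hΓ₁' := hΓ₁.trans inter_subset_left
  have hΓ₂' := hΓ₂.trans inter_subset_left
  -- uniform bounds on the interface
  have hab₁ : ∀ x ∈ frontier Ω₁, α₀ ≤ a₁ x ∧ a₁ x ≤ α₁ := fun x hx =>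
    bounds_closure ha₁b ha₁.continuousOn x (hΓ₁' hx)
  have hab₂ : ∀ x ∈ frontier Ω₁, α₀ ≤ a₂ x ∧ a₂ x ≤ α₁ := fun x hx =>
    bounds_closure ha₂b ha₂.continuousOn x (hΓ₂' hx)
  have hac₁ := ha₁.continuousOn.mono hΓ₁'
  have hac₂ := ha₂.continuousOn.mono hΓ₂'
  obtain ⟨δ, hδ, hδΓ⟩ := exists_uniform_jump hΓc hac₁ hac₂
    (fun x hx => hα₀.trans_le (hab₂ x hx).1) hjump
  obtain ⟨A₁, hA₁⟩ := hΓc.exists_bound_of_continuousOn (hα_in.mono hΓ₁')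
  obtain ⟨A₂, hA₂⟩ := hΓc.exists_bound_of_continuousOn (hα_out.mono hΓ₂')
  obtain ⟨Q, hQ⟩ := exists_lipschitzWith_minkowski ho hc hx₁
  have hM : 0 < 1 + M₁ := by linarith
  -- With zero diameter the bound on `β` would be a division by zero, which has the value `0`,
  -- contradicting `0 < β`.
  have hD : 0 < Metric.diam Ω := by
    refine Metric.diam_nonneg.lt_of_ne fun h => ?_
    rw [← h] at hβ'
    simp only [ne_eq, OfNat.ofNat_ne_zero, not_false_eq_true, zero_pow, zero_mul, div_zero] at hβ'
    linarith
  obtain ⟨s₀, hs₀, C, hC, c, hc0, key⟩ := exists_interfaceDensity_ge (Q := Q) (T := T)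
    (a := max |A₁| |A₂|) hα₀ (hα₀.trans_le hα₀α₁) hγ hδ hD Q.2 hβ hβ' hM (by positivity)
  refine ⟨s₀, hs₀, C, hC, c, hc0, ?_⟩
  intro s hs v₁ v₂ w₁ w₂ hv₁ hv₂ htr hw₁ hw₂
  have hs0 : 0 < s := hs₀.trans_le hs
  -- the weights on the interface
  have hp1 : ∀ x ∈ frontier Ω₁, minkowski Ω₁ x₁ x = 1 := fun x hx =>
    (minkowski_eq_one_iff ho hc hx₁).2 hx
  have hμ₁ : ∀ x ∈ frontier Ω₁, innerWeight Ω₁ x₁ η M₁ x = 1 + M₁ := fun x hx =>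
    innerWeight_eq ho hη M₁ hx (hp1 x hx)
  have hμ₂ : ∀ x ∈ frontier Ω₁, outerWeight Ω₁ x₁ γ M₁ x = 1 + M₁ := fun x hx =>
    outerWeight_eq γ M₁ (hp1 x hx)
  have hq := fun x (hx : x ∈ frontier Ω₁) => hasGradientAt_minkowski hk ho hc hΩ₁s hx₁ hx
  have hm₁ : ∀ x ∈ frontier Ω₁, HasGradientWithinAt (innerWeight Ω₁ x₁ η M₁)
      ((2 * minkowskiSlope Ω₁ x₁ x) • outwardNormal Ω₁ x) (closure Ω₁) x := fun x hx =>
    hasGradientWithinAt_innerWeight ho hη M₁ hx (hp1 x hx) (hq x hx).2.2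
  have hm₂ : ∀ x ∈ frontier Ω₁, HasGradientWithinAt (outerWeight Ω₁ x₁ γ M₁)
      ((2 * γ * minkowskiSlope Ω₁ x₁ x) • outwardNormal Ω₁ x) (closure (Ω \ closure Ω₁)) x :=
    fun x hx =>
      (hasGradientAt_outerWeight γ M₁ (hp1 x hx) (hq x hx).2.2).hasFDerivAt.hasFDerivWithinAt
  -- integrability
  have cont : ∀ {f : EuclideanSpace ℝ (Fin d) → ℝ}, ContinuousOn f (frontier Ω₁) →
      MemLp (fun z => f z.2) ⊤ (lateralMeasure T (frontier Ω₁)) := fun hf =>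
    memLp_top_of_continuousOn hΓc (hf.comp continuousOn_snd fun z hz => hz.2)
  have hqL := memLp_minkowskiSlope (T := T) (Γ := frontier Ω₁) ho hc hx₁
  have hνL := memLp_outwardNormal (T := T) hk ho hc hΩ₁s hx₁
  have hmL : ∀ r : ℝ, MemLp (fun z => (r * minkowskiSlope Ω₁ x₁ z.2) • outwardNormal Ω₁ z.2) ⊤
      (lateralMeasure T (frontier Ω₁)) := fun r => hνL.smul (hqL.const_mul r) (r := ⊤)
  have hwc₁ := continuousOn_conjugate (β := β) (s := s) hΓ₁ hμ₁ hv₁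
  have hwc₂ := continuousOn_conjugate (β := β) (s := s) hΓ₂ hμ₂ hv₂
  have hwt₁ := continuousOn_timeDeriv_conjugate (β := β) (s := s) hT hU₁ hΓ₁ hμ₁ hv₁
  have hwt₂ := continuousOn_timeDeriv_conjugate (β := β) (s := s) hT hU₂ hΓ₂ hμ₂ hv₂
  have hG₁ := memLp_spaceGrad_conjugate (β := β) (s := s) hΓc hT hΩ hU₁ hΓ₁ hμ₁ hm₁ (hmL 2) hv₁
  have hG₂ := memLp_spaceGrad_conjugate (β := β) (s := s) hΓc hT hΩ hU₂ hΓ₂ hμ₂ hm₂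
    (hmL (2 * γ)) hv₂
  have hwd : ∀ z ∈ Ioo (-T) T ×ˢ frontier Ω₁, HasDerivAt
      (fun t => conjugate s (weight β (innerWeight Ω₁ x₁ η M₁)) v₁ (t, z.2))
      (timeDeriv T (conjugate s (weight β (innerWeight Ω₁ x₁ η M₁)) v₁) z) z.1 := fun z hz =>
    (hasDerivWithinAt_conjugate hT hv₁ ⟨Ioo_subset_Icc_self hz.1, hΓ₁ hz.2⟩).1.hasDerivAt
      (Icc_mem_nhds hz.1.1 hz.1.2)
  have hpt := fun z (hz : z ∈ Ioo (-T) T ×ˢ frontier Ω₁) =>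
    boundaryDensity_add_conjugate (α₁ := α_in z.2) (α₂ := α_out z.2) (s := s) (β := β) hk hT hΩ ho
      hc hΩ₁s hx₁ hU₁ hU₂ hΓ₁ hΓ₂ hv₁ hv₂ (fun y hy => (htr y hy).1) hμ₁ hμ₂ hz (hm₁ z.2 hz.2)
      (hm₂ z.2 hz.2) (htr z hz).2
  have hφm₁ := memLp_spaceGrad_weight (β := β) hΓc hU₁ hΓ₁ hm₁ (hmL 2)
  have hφm₂ := memLp_spaceGrad_weight (β := β) hΓc hU₂ hΓ₂ hm₂ (hmL (2 * γ))
  have hφt₁ := memLp_timeDeriv_weight (β := β) (μ := innerWeight Ω₁ x₁ η M₁) hΓc hT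
  have hφt₂ := memLp_timeDeriv_weight (β := β) (μ := outerWeight Ω₁ x₁ γ M₁) hΓc hT
  simp only [← hφ₁, ← hφ₂, ← hw₁, ← hw₂] at hwc₁ hwc₂ hwt₁ hwt₂ hG₁ hG₂ hwd hpt hφm₁ hφm₂ hφt₁ hφt₂
  obtain ⟨hI₁, hS₁⟩ := sum_boundaryTerm s (cont hac₁) (cont (hα_in.mono hΓ₁')) hνL
    (memLp_top_of_continuousOn hΓc hwc₁) (memLp_top_of_continuousOn hΓc hwt₁) hφt₁ hφm₁ hG₁
  obtain ⟨hI₂, hS₂⟩ := sum_boundaryTerm (ν := fun x => -outwardNormal Ω₁ x) s (cont hac₂)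
    (cont (hα_out.mono hΓ₂')) hνL.neg
    (memLp_top_of_continuousOn hΓc hwc₂) (memLp_top_of_continuousOn hΓc hwt₂) hφt₂ hφm₂ hG₂
  obtain ⟨hIt, hIt0⟩ := integral_lateralMeasure_time_nonneg hΓc hT
    (k := fun x => minkowskiSlope Ω₁ x₁ x * (γ * a₂ x - a₁ x))
    (memLp_top_mul hqL (cont (f := fun x => γ * a₂ x - a₁ x) (by fun_prop)))
    (fun x hx => mul_nonneg (norm_nonneg _) (hδ.le.trans (hδΓ x hx).1)) hwc₁ hwt₁ hwd
  have sq : ∀ {f : ℝ × EuclideanSpace ℝ (Fin d) → ℝ},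
      MemLp f ⊤ (lateralMeasure T (frontier Ω₁)) →
      MemLp (fun z => f z ^ 2) ⊤ (lateralMeasure T (frontier Ω₁)) := fun hf => by
    simpa only [pow_two] using memLp_top_mul hf hf
  have hgL : MemLp (normalDeriv Ω₁ (outwardNormal Ω₁) w₁) ⊤ (lateralMeasure T (frontier Ω₁)) :=
    memLp_top_inner hG₁ hνL
  have htL : MemLp (tangentialGrad Ω₁ (outwardNormal Ω₁) w₁) ⊤
      (lateralMeasure T (frontier Ω₁)) := hG₁.sub (hνL.smul hgL (r := ⊤))
  have hw2 := sq (memLp_top_of_continuousOn hΓc hwc₁)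
  have hIE : Integrable (fun z => timeDeriv T w₁ z ^ 2 + s ^ 2 * w₁ z ^ 2
      + ‖tangentialGrad Ω₁ (outwardNormal Ω₁) w₁ z‖ ^ 2
      + normalDeriv Ω₁ (outwardNormal Ω₁) w₁ z ^ 2) (lateralMeasure T (frontier Ω₁)) :=
    ((((sq (memLp_top_of_continuousOn hΓc hwt₁)).add (hw2.const_mul (s ^ 2))).add
      (sq htL.norm)).add (sq hgL)).integrable le_top
  -- the part of the interface where the weight is negative
  have hφΓ : ∀ z ∈ Ioo (-T) T ×ˢ frontier Ω₁, φ z = 1 + M₁ - β * z.1 ^ 2 := fun z hz => by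
    simp only [hφ, weight, spatialWeight, if_pos (hΓ₁' hz.2), hμ₁ z.2 hz.2]
  have hN : MeasurableSet {z : ℝ × EuclideanSpace ℝ (Fin d) |
      z ∈ Ioo (-T) T ×ˢ frontier Ω₁ ∧ φ z < 0} := by
    -- On the interface `φ` depends on time alone, which makes the set measurable.
    have : {z : ℝ × EuclideanSpace ℝ (Fin d) | z ∈ Ioo (-T) T ×ˢ frontier Ω₁ ∧ φ z < 0}
        = Ioo (-T) T ×ˢ frontier Ω₁ ∩ {z | 1 + M₁ - β * z.1 ^ 2 < 0} := by
      ext z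
      exact and_congr_right fun hz => by rw [hφΓ z hz]; rfl
    rw [this]
    exact (measurableSet_Ioo.prod hΓc.measurableSet).inter
      (isOpen_lt (by fun_prop) continuous_const).measurableSet
  set N := {z : ℝ × EuclideanSpace ℝ (Fin d) | z ∈ Ioo (-T) T ×ˢ frontier Ω₁ ∧ φ z < 0} with hNdef
  have hIN := (hw2.integrable le_top).indicator hN
  -- comparison of the densities
  have hmono := integral_mono_ae
    (((hIE.const_mul (c * s)).sub (hIN.const_mul (C * s ^ 3))).add
      (hIt.const_mul (4 * β * s ^ 2))) (hI₁.add hI₂) (by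
    filter_upwards [hae] with z hz
    obtain ⟨hsum, htr'⟩ := hpt z hz
    have hz2 := hz.2
    have hχ : N.indicator (fun z => w₁ z ^ 2) z = N.indicator 1 z * w₁ z ^ 2 := by
      by_cases h : z ∈ N <;> simp [h]
    have hcase : N.indicator (1 : ℝ × EuclideanSpace ℝ (Fin d) → ℝ) z = 1 ∨
        N.indicator (1 : ℝ × EuclideanSpace ℝ (Fin d) → ℝ) z = 0 ∧ β * z.1 ^ 2 ≤ 1 + M₁ := by
      by_cases h : z ∈ N
      · exact Or.inl (by simp [h])
      · refine Or.inr ⟨by simp [h], ?_⟩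
        have h2 : ¬ φ z < 0 := fun h0 => h ⟨hz, h0⟩
        rw [hφΓ z hz] at h2
        linarith
    have hfin := key s hs (a₁ z.2) (a₂ z.2) (α_in z.2) (α_out z.2) (minkowskiSlope Ω₁ x₁ z.2) z.1
      (N.indicator 1 z) (w₁ z) (timeDeriv T w₁ z) _ _ _ (hab₁ _ hz2).1 (hab₁ _ hz2).2
      (hab₂ _ hz2).1 (hab₂ _ hz2).2 (hδΓ _ hz2).1 (hδΓ _ hz2).2
      (one_le_minkowskiSlope_mul hk ho hc hΩ₁s hx₁ hz2 (Metric.dist_le_diam_of_mem hΩb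
        (hΓ₁ hz2).2 (hΩ₁Ω (subset_closure hx₁)))) (minkowskiSlope_le hQ)
      (abs_le.2 ⟨hz.1.1.le, hz.1.2.le⟩)
      ((hA₁ _ hz2).trans ((le_abs_self _).trans (le_max_left _ _)))
      ((hA₂ _ hz2).trans ((le_abs_self _).trans (le_max_right _ _)))
      (sq_nonneg ‖tangentialGrad Ω₁ (outwardNormal Ω₁) w₁ z‖) hcase htr'
    simp only [Pi.add_apply, Pi.sub_apply, hχ]
    exact hfin.trans hsum.ge)
  have hsub := integral_sub (hIE.const_mul (c * s)) (hIN.const_mul (C * s ^ 3))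
  have hadd := integral_add ((hIE.const_mul (c * s)).sub (hIN.const_mul (C * s ^ 3)))
    (hIt.const_mul (4 * β * s ^ 2))
  simp only [Pi.add_apply, Pi.sub_apply, integral_const_mul, integral_indicator hN]
    at hsub hadd hmono
  have hE0 : 0 ≤ ∫ z, (timeDeriv T w₁ z ^ 2 + s ^ 2 * w₁ z ^ 2
      + ‖tangentialGrad Ω₁ (outwardNormal Ω₁) w₁ z‖ ^ 2
      + normalDeriv Ω₁ (outwardNormal Ω₁) w₁ z ^ 2) ∂(lateralMeasure T (frontier Ω₁)) :=
    integral_nonneg fun z => by positivity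
  have hends : 0 ≤ C * s ^ 2 * ∫ x, (w₁ (T, x) ^ 2 + w₁ (-T, x) ^ 2)
      ∂(surfaceMeasure (frontier Ω₁)) :=
    mul_nonneg (by positivity) (integral_nonneg fun x => by positivity)
  have hβs : 0 ≤ 4 * β * s ^ 2 * ∫ z, minkowskiSlope Ω₁ x₁ z.2 * (γ * a₂ z.2 - a₁ z.2)
      * (2 * z.1 * w₁ z * timeDeriv T w₁ z + w₁ z ^ 2) ∂(lateralMeasure T (frontier Ω₁)) :=
    mul_nonneg (by positivity) hIt0
  have hcs := mul_nonneg (mul_pos hc0 hs0).le hE0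
  have hD' := integral_add hI₁ hI₂
  rw [Finset.sum_add_distrib, hS₁, hS₂]
  -- The time integral `hβs` is nonnegative and is dropped. The end-point term is only subtracted on
  -- the left, so its nonnegativity suffices; dropping the energy by `hcs` gives the first estimate.
  constructor <;> linarith only [hmono, hsub, hadd, hD', hβs, hcs, hends]
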